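/- Fix integers $n\ge 2$, $d\ge 2$, $m\ge 1$. Let $q_1,\dots,q_{2^d}$ be the points of $\{0,1\}^d$, $q_0=(\tfrac12,\dots,\tfrac12)$, and for $1\le i\le 2^d$, $1\le j\le n$ let $$F_{i,j}(x)=\tfrac{1}{2n-1}x+\tfrac{2n-2}{2n-1}\Big(\tfrac{n-j}{n-1}q_i+\tfrac{j-1}{n-1}q_0\Big).$$ Let $V_0=\{q_1,\dots,q_{2^d}\}$, let $E_0$ be the set of all pairs of distinct points of $V_0$, and put $V_{k+1}=\bigcup_{i,j}F_{i,j}V_k$, $E_{k+1}=\{\{F_{i,j}x,F_{i,j}y\}:\{x,y\}\in E_k,\ 1\le i\le 2^d,\ 1\le j\le n\}$. On the graph $(V_m,E_m)$ let $\Delta_m f(x)=N_x^{-1}\sum_{y:\{x,y\}\in E_m}f(y)-f(x)$, where $N_x$ is the degree of $x$. A real number $\lambda$ is a Dirichlet eigenvalue of $-\Delta_m$ if there is $f\ne0$ on $V_m$ with $f|_{V_0}=0$ and $-\Delta_mf=\lambda f$ on $V_m\setminus V_0$; its multiplicity $M_{m,D}(\lambda)$ is the dimension of the space of all such $f$ (together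 with $0$). Let $\sigma_{m,D}$ be the set of Dirichlet eigenvalues. Let $T_k,U_k$ be the Chebyshev polynomials of the first and second kind, $t=1-(2^d-1)\lambda$, and $$R_{n,d}(\lambda)=1+(\lambda-1)U_{n-1}(t)^2+(t+\lambda+1)U_{n-1}(t)U_{n-2}(t)-t\,U_{n-2}(t)^2,$$ $$S_{n,d}(\lambda)=T_n(t)+(2^d-1)T_{n-1}(t),\qquad A_{n,d}(\lambda)=U_{n-1}(t)+U_{n-2}(t).$$ **Theorem.** (i) For every $x\in I:=[0,\frac{2^d}{2^d-1}]$ the equation $R_{n,d}(\lambda)=x$ has exactly $2n-1$ distinct real solutions, all of them in $I$; write them as $\psi_0(x)<\psi_1(x)<\dots<\psi_{2n-2}(x)$. The polynomial $S_{n,d}$ has exactly $n$ distinct real roots $\alpha_1,\dots,\alpha_n$, and $A_{n,d}$ has exactly $n-1$ distinct real roots $\beta_1,\dots,\beta_{n-1}$; all of them lie in $I$. (ii) For a word $v=v_1\cdots v_k$ in the letters $0,1,\dots,2n-2$ put $|v|=k$ and $\psi_v=\psi_{v_k}\circ\cdots\circ\psi_{v_1}$ (the identity if $v=\emptyset$).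 Then $$\begin{aligned}\sigma_{m,D}=&\ \big\{\psi_v(\tfrac{2^d}{2^d-1}): |v|\le m-1,\ v=\emptyset\text{ or }v_1\in\{0,2,4,\dots,2n-4\}\big\}\\ &\cup\{\psi_v(\alpha_i):1\le i\le n,\ |v|=m-1\}\ \cup\ \{\psi_v(\beta_i):1\le i\le n-1,\ |v|\le m-1\}.\end{aligned}$$ (iii) The multiplicities are $$\begin{cases}M_{m,D}\big(\psi_v(\tfrac{2^d}{2^d-1})\big)=(2^dn-2^d+1)^{m-|v|}(2^d-2)+1-2^d,& |v|\le m-1,\ v=\emptyset\text{ or }v_1\in\{0,2,\dots,2n-4\},\\ M_{m,D}(\psi_v(\alpha_i))=1,&1\le i\le n,\ |v|=m-1,\\ M_{m,D}(\psi_v(\beta_i))=2^d-1,&1\le i\le n-1,\ |v|\le m-1.\end{cases}$$ -/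

import Mathlib

open Polynomial

namespace Vicsek

noncomputable section

/-- The corner of the cube `[0,1]^d` with 0-1 coordinates `a`; these are the points `q_i`. -/
def corner {d : ℕ} (a : Fin d → Bool) : Fin d → ℝ := fun k => if a k then 1 else 0

/-- The centre `q_0` of the cube. -/
def center (d : ℕ) : Fin d → ℝ := fun _ => 1 / 2

/-- The contraction `F_{i,j}` of the iterated function system (used for `1 ≤ j ≤ n`), where the
corner `q_i` is given by its coordinates `a`. -/
def contraction (n : ℕ) {d : ℕ} (a : Fin d → Bool) (j : ℕ) (x : Fin d → ℝ) : Fin d → ℝ :=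
  (1 / (2 * (n : ℝ) - 1)) • x +
    ((2 * (n : ℝ) - 2) / (2 * (n : ℝ) - 1)) •
      ((((n : ℝ) - j) / ((n : ℝ) - 1)) • corner a + (((j : ℝ) - 1) / ((n : ℝ) - 1)) • center d)

open Classical in
/-- The vertex set `V_m` of the level-`m` graph: `V_0` is the set of corners of the cube, and
`V_{m+1}` is the union of the sets `F_{i,j} V_m`. -/
def vertices (n d : ℕ) : ℕ → Finset (Fin d → ℝ)
  | 0 => Finset.univ.image corner
  | m + 1 => (Finset.univ : Finset (Fin d → Bool)).biUnion fun a =>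
      (Finset.Icc 1 n).biUnion fun j => (vertices n d m).image (contraction n a j)

/-- The edge set `E_m` of the level-`m` graph: `E_0` consists of all pairs of distinct corners, and
`E_{m+1}` of the images of the edges in `E_m` under the maps `F_{i,j}`. -/
def edges (n d : ℕ) : ℕ → Set (Sym2 (Fin d → ℝ))
  | 0 => {e | ∃ a b : Fin d → Bool, a ≠ b ∧ e = s(corner a, corner b)}
  | m + 1 => {e | ∃ a : Fin d → Bool, ∃ j ∈ Finset.Icc 1 n, ∃ e' ∈ edges n d m,
      e = e'.map (contraction n a j)}

/-- The level-`m` approximating graph `G_m = (V_m, E_m)`. -/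
def graph (n d m : ℕ) : SimpleGraph (vertices n d m) :=
  (SimpleGraph.fromEdgeSet (edges n d m)).comap fun x : vertices n d m => (x : Fin d → ℝ)

open Classical in
/-- The graph Laplacian
`Δ_m f(x) = N_x⁻¹ ∑_{y ∼ x} f(y) - f(x)`, with `N_x` the degree of `x`. -/
def laplacian (n d m : ℕ) (f : vertices n d m → ℝ) (x : vertices n d m) : ℝ :=
  ((graph n d m).degree x : ℝ)⁻¹ * (∑ y ∈ (graph n d m).neighborFinset x, f y) - f x

/-- The space of functions `f` on `V_m` vanishing on the boundary `V_0` with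
`-Δ_m f = lam • f` on `V_m \ V_0`. -/
def dirichletEigenspace (n d m : ℕ) (lam : ℝ) : Submodule ℝ (vertices n d m → ℝ) where
  carrier := {f | (∀ x : vertices n d m, (x : Fin d → ℝ) ∈ vertices n d 0 → f x = 0) ∧
    ∀ x : vertices n d m, (x : Fin d → ℝ) ∉ vertices n d 0 → -laplacian n d m f x = lam * f x}
  zero_mem' := by
    refine ⟨fun x _ => rfl, fun x _ => ?_⟩
    simp [laplacian]
  add_mem' := by
    rintro f g ⟨hf, hf'⟩ ⟨hg, hg'⟩
    refine ⟨fun x hx => by simp [hf x hx, hg x hx], fun x hx => ?_⟩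
    have h1 := hf' x hx
    have h2 := hg' x hx
    simp only [laplacian, Pi.add_apply, Finset.sum_add_distrib] at *
    linear_combination h1 + h2
  smul_mem' := by
    rintro c f ⟨hf, hf'⟩
    refine ⟨fun x hx => by simp [hf x hx], fun x hx => ?_⟩
    have h1 := hf' x hx
    simp only [laplacian, Pi.smul_apply, smul_eq_mul, ← Finset.mul_sum] at *
    linear_combination c * h1

/-- The Dirichlet spectrum `σ_{m,D}` of `-Δ_m`: those `lam` having a nonzero Dirichlet
eigenfunction. -/
def dirichletSpectrum (n d m : ℕ) : Set ℝ := {lam | dirichletEigenspace n d m lam ≠ ⊥}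

/-- The multiplicity `M_{m,D}(lam)` of a Dirichlet eigenvalue. -/
def dirichletMultiplicity (n d m : ℕ) (lam : ℝ) : ℕ :=
  Module.finrank ℝ (dirichletEigenspace n d m lam)

/-- `t = 1 - (2^d - 1) λ`, as a polynomial in `λ`. -/
def tPoly (d : ℕ) : ℝ[X] := 1 - C ((2 : ℝ) ^ d - 1) * X

/-- The Chebyshev polynomial of the first kind evaluated at `t`, as a polynomial in `λ`. -/
def chebT (d : ℕ) (k : ℤ) : ℝ[X] := (Chebyshev.T ℝ k).comp (tPoly d)

/-- The Chebyshev polynomial of the second kind evaluated at `t`, as a polynomial in `λ`. -/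
def chebU (d : ℕ) (k : ℤ) : ℝ[X] := (Chebyshev.U ℝ k).comp (tPoly d)

/-- The spectral decimation polynomial `R_{n,d}(λ)`. -/
def R (n d : ℕ) : ℝ[X] :=
  1 + (X - 1) * chebU d (n - 1) ^ 2 + (tPoly d + X + 1) * chebU d (n - 1) * chebU d (n - 2)
    - tPoly d * chebU d (n - 2) ^ 2

/-- `S_{n,d}(λ) = T_n(t) + (2^d - 1) T_{n-1}(t)`. -/
def S (n d : ℕ) : ℝ[X] := chebT d n + C ((2 : ℝ) ^ d - 1) * chebT d (n - 1)

/-- `A_{n,d}(λ) = U_{n-1}(t) + U_{n-2}(t)`. -/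
def A (n d : ℕ) : ℝ[X] := chebU d (n - 1) + chebU d (n - 2)

/-- The number `2^d / (2^d - 1)`. -/
def top (d : ℕ) : ℝ := (2 : ℝ) ^ d / ((2 : ℝ) ^ d - 1)

open Classical in
/-- The inverse branches `ψ_0, …, ψ_{2n-2}` of `R_{n,d}` in increasing order: `ψ_l(x)` is the
entry with index `l` (counted from `0`) of the increasing list of the distinct real solutions `y`
of `R_{n,d}(y) = x`. (The value is `0` if there are at most `l` solutions.) -/
def branch (n d l : ℕ) (x : ℝ) : ℝ :=
  ((R n d - C x).roots.toFinset.sort (· ≤ ·)).getD l 0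

/-- `ψ_v = ψ_{v_k} ∘ ⋯ ∘ ψ_{v_1}` for a word `v = v_1 ⋯ v_k` in the letters `0, …, 2n-2`; the
identity for the empty word. -/
def branchWord (n d : ℕ) (v : List (Fin (2 * n - 1))) (x : ℝ) : ℝ :=
  v.foldl (fun (y : ℝ) (l : Fin (2 * n - 1)) => branch n d l.val y) x

/-- The word is empty or its first letter is one of `0, 2, 4, …, 2n-4`. -/
def Admissible {n : ℕ} (v : List (Fin (2 * n - 1))) : Prop :=
  ∀ l ∈ v.head?, Even (l : ℕ) ∧ (l : ℕ) + 4 ≤ 2 * n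

end

end Vicsek

namespace Vicsek

/-!
A function on the level `m + 1` graph satisfying the eigenvalue equation at the interior points of
the arms and at the arm ends is, by the Chebyshev recursion along the arms, determined by its values
at the cell corners, and it solves the equation for `lam` at level `m + 1` when the corner values
solve it for `R lam` at level `m`. This carries Dirichlet eigenspaces from one level to the next;
the exceptional values `top d`, the roots of `A` and, for `m = 1`, the roots of `S` supply further
eigenfunctions. The dimensions obtained in this way add up to the number of vertices outside `V₀`,
which bounds the sum of all multiplicities, so there are no others.
-/

noncomputable section

universe u

section ChebyshevU

variable {K : Type*} [CommRing K] (t : K) (j : ℤ)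

/-- The value `U_j(t)` of the Chebyshev polynomial of the second kind. -/
def evalU : K := (Chebyshev.U K j).eval t

theorem evalU_sub_one : evalU t (j - 1) = 2 * t * evalU t j - evalU t (j + 1) := by
  simp [evalU, Chebyshev.U_sub_one]

@[simp] theorem evalU_zero : evalU t 0 = 1 := by simp [evalU]

@[simp] theorem evalU_neg_one : evalU t (-1) = 0 := by simp [evalU]

theorem evalU_sq_add_evalU_sq :
    evalU t (j + 1) ^ 2 - 2 * t * evalU t (j + 1) * evalU t j + evalU t j ^ 2 = 1 := by
  have h := congrArg (eval (2 * t)) (Chebyshev.S_sq_add_S_sq K j)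
  have hS : ∀ k, (Chebyshev.S K k).eval (2 * t) = evalU t k := fun k => by
    rw [evalU, ← Chebyshev.S_comp_two_mul_X, eval_comp]; simp
  simp only [eval_add, eval_sub, eval_mul, eval_pow, eval_X, eval_one, hS] at h
  linear_combination h

end ChebyshevU

/-- A finite family of cells, each with corners indexed by `Q`, glued along common vertices,
together with distinguished boundary vertices. The graph it encodes joins any two corners of
each cell. -/
structure CellSystem (Q : Type u) where
  Vertex : Type u
  Cell : Type u
  [fintypeVertex : Fintype Vertex]
  [fintypeCell : Fintype Cell]
  corner : Cell → Q → Vertex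
  bdry : Q → Vertex

namespace CellSystem

open Module

attribute [instance] fintypeVertex fintypeCell

variable {K : Type*} {Q : Type u}

section Dirichlet

variable (K) [CommRing K] (X : CellSystem Q)

/-- The functions vanishing at the boundary vertices. -/
def dirichlet : Submodule K (X.Vertex → K) :=
  ⨅ a, LinearMap.ker (LinearMap.proj (X.bdry a) : (X.Vertex → K) →ₗ[K] K)

variable {K X}

theorem mem_dirichlet {f : X.Vertex → K} : f ∈ X.dirichlet K ↔ ∀ a, f (X.bdry a) = 0 := by
  simp [dirichlet]

end Dirichlet

section Eigenspace

variable (K) [CommRing K] [Fintype Q] (X : CellSystem Q)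

/-- The sum of a function over the corners of a cell. -/
def cellSum (w : X.Cell) : (X.Vertex → K) →ₗ[K] K := ∑ a, LinearMap.proj (X.corner w a)

variable {K}

theorem cellSum_apply (w : X.Cell) (f : X.Vertex → K) :
    X.cellSum K w f = ∑ a, f (X.corner w a) := by
  simp [cellSum]

/-- The bilinear form whose vanishing against all `g` that are zero on the boundary is the weak
form of the Dirichlet eigenvalue equation. In a cell with `P` corners the sum over the neighbours
of a vertex is the cell sum minus its own value, so the eigenvalue `lam` of the graph Laplacian
corresponds to `s = P - (P - 1) * lam`. -/
def form (s : K) : (X.Vertex → K) →ₗ[K] (X.Vertex → K) →ₗ[K] K :=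
  ∑ w, ∑ a, (X.cellSum K w - s • LinearMap.proj (X.corner w a)).smulRight
    (LinearMap.proj (X.corner w a))

theorem form_apply (s : K) (f g : X.Vertex → K) : X.form s f g =
    ∑ w, ∑ a, (X.cellSum K w f - s * f (X.corner w a)) * g (X.corner w a) := by
  simp [form, LinearMap.sum_apply]

/-- The weak Dirichlet eigenspace with parameter `s`, see `CellSystem.form`. -/
def eigenspace (s : K) : Submodule K (X.Vertex → K) :=
  X.dirichlet K ⊓ ⨅ g ∈ X.dirichlet K, LinearMap.ker ((X.form s).flip g)

variable {X} in
theorem mem_eigenspace {s : K} {f : X.Vertex → K} :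
    f ∈ X.eigenspace s ↔ f ∈ X.dirichlet K ∧ ∀ g ∈ X.dirichlet K, X.form s f g = 0 := by
  simp [eigenspace]

end Eigenspace

section Refine

variable (L : ℕ) {opp : Q → Q} (hopp : ∀ i, opp i ≠ i)

/-- The vertices created inside a cell when it is subdivided: `(i, j, a)` stands for the corner
`a` of the `j`-th cell on the arm that starts at the corner `i`. -/
abbrev NewVertex (Q : Type u) (L : ℕ) : Type u := {p : Q × Fin (L + 1) × Q // p.2.2 ≠ p.1}

variable {L} in
/-- The vertices along the diagonal of the `i`-th arm of the subdivision of the cell `w`, from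
the corner of `w` to the central cell. -/
def spine (X : CellSystem Q) (w : X.Cell) (i : Q) :
    Fin (L + 2) → X.Vertex ⊕ (X.Cell × NewVertex Q L) :=
  Fin.cons (Sum.inl (X.corner w i)) fun j => Sum.inr (w, ⟨(i, j, opp i), hopp i⟩)

variable [Fintype Q] [DecidableEq Q]

/-- Replace each cell by a central cell `none` and arms of cells `some (i, j)`, `j ≤ L`, joining
its corners to those of the old cell. Consecutive cells of the `i`-th arm share the corner
`opp i` of the former, which is the corner `i` of the latter. -/
abbrev refine (X : CellSystem Q) : CellSystem Q where
  Vertex := X.Vertex ⊕ (X.Cell × NewVertex Q L)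
  Cell := X.Cell × Option (Q × Fin (L + 1))
  corner
    | (w, none), a => X.spine hopp w a (Fin.last _)
    | (w, some (i, j)), a =>
      if h : a = i then X.spine hopp w i j.castSucc else Sum.inr (w, ⟨(i, j, a), h⟩)
  bdry a := Sum.inl (X.bdry a)

variable (X : CellSystem Q) (w : X.Cell) (i : Q) (j : Fin (L + 1))

theorem refine_corner_none (a : Q) :
    (X.refine L hopp).corner (w, none) a = X.spine hopp w a (Fin.last _) :=
  rfl

theorem refine_corner_self :
    (X.refine L hopp).corner (w, some (i, j)) i = X.spine hopp w i j.castSucc :=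
  dif_pos rfl

theorem refine_corner_opp :
    (X.refine L hopp).corner (w, some (i, j)) (opp i) = X.spine hopp w i j.succ :=
  dif_neg (hopp i)

theorem refine_corner_of_ne {a : Q} (h : a ≠ i) :
    (X.refine L hopp).corner (w, some (i, j)) a = Sum.inr (w, ⟨(i, j, a), h⟩) :=
  dif_neg h

theorem card_newVertex : Fintype.card (NewVertex Q L) =
    Fintype.card Q * (L + 1) * (Fintype.card Q - 1) := by
  let e : NewVertex Q L ≃ Σ p : Q × Fin (L + 1), {a : Q // a ≠ p.1} :=
    { toFun := fun p => ⟨(p.1.1, p.1.2.1), ⟨p.1.2.2, p.2⟩⟩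
      invFun := fun p => ⟨(p.1.1, p.1.2, p.2.1), p.2.2⟩ }
  rw [Fintype.card_congr e, Fintype.card_sigma]
  simp [Fintype.card_subtype_compl]

theorem card_refine_vertex : Fintype.card (X.refine L hopp).Vertex =
    Fintype.card X.Vertex + Fintype.card X.Cell *
      (Fintype.card Q * (L + 1) * (Fintype.card Q - 1)) := by
  rw [← card_newVertex, ← Fintype.card_prod]
  exact Fintype.card_sum

theorem card_refine_cell : Fintype.card (X.refine L hopp).Cell =
    Fintype.card X.Cell * (Fintype.card Q * (L + 1) + 1) :=
  (Fintype.card_prod _ _).trans (by simp)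

end Refine

section Arm

variable [CommRing K] (t a b : K) (j : ℤ)

/-- The value at the `j`-th spine vertex of an arm whose spine starts with the value `a` and whose
outermost cell has the value `b` at its free vertices, i.e. those off the spine. -/
def spineVal : K :=
  (t + 1) * evalU t (j - 1) * b - (evalU t (j - 1) + evalU t (j - 2)) * a

/-- The value at the free vertices of the `j`-th cell of an arm, see `CellSystem.spineVal`. -/
def freeVal : K :=
  (evalU t j + evalU t (j - 1)) * b - 2 * evalU t (j - 1) * a

theorem spineVal_zero : spineVal t a b 0 = a := by
  have h := evalU_sub_one t (-1)
  norm_num at h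
  simp [spineVal, h]

theorem freeVal_zero : freeVal t a b 0 = b := by simp [freeVal]

theorem spineVal_add_one :
    spineVal t a b (j + 1) = (t + 1) * freeVal t a b j - spineVal t a b j := by
  have h := evalU_sub_one t (j - 1)
  simp only [sub_sub, sub_add_cancel, one_add_one_eq_two] at h
  simp only [spineVal, freeVal, add_sub_cancel_right, h, show j + 1 - 2 = j - 1 by ring]
  ring

theorem freeVal_add_one :
    freeVal t a b (j + 1) = 2 * spineVal t a b (j + 1) - freeVal t a b j := by
  have h := evalU_sub_one t j
  simp only [spineVal, freeVal, add_sub_cancel_right, show j + 1 - 2 = j - 1 by ring]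
  linear_combination b * h

end Arm

section Extend

theorem sum_eq_of_forall_ne [CommRing K] [Fintype Q] {i k : Q} (hik : k ≠ i) {F : Q → K} {r : K}
    (hr : ∀ a, a ≠ i → a ≠ k → F a = r) :
    ∑ a, F a = F i + F k + (Fintype.card Q - 2) * r := by
  classical
  have h : ∀ a, F a = r + (if a = i then F i - r else 0) + (if a = k then F k - r else 0) := by
    intro a
    by_cases hi : a = i
    · simp [hi, hik.symm]
    · by_cases hk : a = k
      · simp [hk, hik]
      · simp [hi, hk, hr a hi hk]
  rw [Finset.sum_congr rfl fun a _ => h a]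
  simp only [Finset.sum_add_distrib, Finset.sum_ite_eq', Finset.mem_univ, if_true,
    Finset.sum_const, Finset.card_univ, nsmul_eq_mul]
  ring
variable [CommRing K] [Fintype Q] [DecidableEq Q] (L : ℕ) {opp : Q → Q} (hopp : ∀ i, opp i ≠ i)

/-- The extension to the refinement of a function `f` on the vertices, along the arms, with value
`b w i` at the free vertices of the outermost cell of the `i`-th arm of `w`. -/
def extend (X : CellSystem Q) (t : K) :
    (X.Vertex → K) × (X.Cell → Q → K) →ₗ[K] (X.refine L hopp).Vertex → K where
  toFun fb := Sum.elim fb.1 fun p => if p.2.1.2.2 = opp p.2.1.1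
    then spineVal t (fb.1 (X.corner p.1 p.2.1.1)) (fb.2 p.1 p.2.1.1) (p.2.1.2.1 + 1)
    else freeVal t (fb.1 (X.corner p.1 p.2.1.1)) (fb.2 p.1 p.2.1.1) p.2.1.2.1
  map_add' fb fb' := by
    ext (v | p)
    · rfl
    · simp only [Sum.elim_inr, Prod.fst_add, Prod.snd_add, Pi.add_apply, spineVal, freeVal]
      split_ifs <;> ring
  map_smul' c fb := by
    ext (v | p)
    · rfl
    · simp only [Sum.elim_inr, Prod.smul_fst, Prod.smul_snd, Pi.smul_apply, smul_eq_mul, spineVal,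
        freeVal, RingHom.id_apply]
      split_ifs <;> ring

variable (X : CellSystem Q) (t : K) (f : X.Vertex → K) (b : X.Cell → Q → K) (w : X.Cell) (i : Q)

theorem extend_spine (j : Fin (L + 2)) : X.extend L hopp t (f, b) (X.spine hopp w i j) =
    spineVal t (f (X.corner w i)) (b w i) j := by
  cases j using Fin.cases <;> simp [extend, spine, spineVal_zero]

theorem extend_corner_of_ne (j : Fin (L + 1)) {a : Q} (hi : a ≠ i) (ha : a ≠ opp i) :
    X.extend L hopp t (f, b) ((X.refine L hopp).corner (w, some (i, j)) a) =
      freeVal t (f (X.corner w i)) (b w i) j := by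
  rw [refine_corner_of_ne _ _ _ _ _ _ hi]
  simp [extend, ha]

theorem cellSum_extend_arm (j : Fin (L + 1)) :
    (X.refine L hopp).cellSum K (w, some (i, j)) (X.extend L hopp t (f, b)) =
      (t + Fintype.card Q - 1) * freeVal t (f (X.corner w i)) (b w i) j := by
  rw [cellSum_apply, sum_eq_of_forall_ne (hopp i) fun a => extend_corner_of_ne L hopp X t f b w i j,
    refine_corner_self, refine_corner_opp, extend_spine, extend_spine]
  simp only [Fin.val_castSucc, Fin.val_succ, Nat.cast_add, Nat.cast_one, spineVal_add_one]
  ring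

theorem cellSum_extend_center :
    (X.refine L hopp).cellSum K (w, none) (X.extend L hopp t (f, b)) =
      ∑ k, spineVal t (f (X.corner w k)) (b w k) (L + 1) := by
  rw [cellSum_apply]
  refine Finset.sum_congr rfl fun k _ => ?_
  rw [refine_corner_none, extend_spine, Fin.val_last, Nat.cast_add, Nat.cast_one]

variable (g : (X.refine L hopp).Vertex → K)

/-- The flux through the `j`-th spine vertex of an arm, which the form of an extended function
telescopes to. -/
def armFlux (j : Fin (L + 2)) : K :=
  (t + Fintype.card Q - 1) * (freeVal t (f (X.corner w i)) (b w i) j -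
    spineVal t (f (X.corner w i)) (b w i) j) * g (X.spine hopp w i j)

theorem form_extend_arm_cell (j : Fin (L + 1)) :
    ∑ a, ((X.refine L hopp).cellSum K (w, some (i, j)) (X.extend L hopp t (f, b)) -
      (t + Fintype.card Q - 1) *
        X.extend L hopp t (f, b) ((X.refine L hopp).corner (w, some (i, j)) a)) *
        g ((X.refine L hopp).corner (w, some (i, j)) a) =
      armFlux L hopp X t f b w i g j.castSucc - armFlux L hopp X t f b w i g j.succ := by
  rw [sum_eq_of_forall_ne (hopp i) (r := 0) fun a hi ha => by
      rw [extend_corner_of_ne L hopp X t f b w i j hi ha, cellSum_extend_arm, sub_self, zero_mul],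
    cellSum_extend_arm, refine_corner_self, refine_corner_opp, extend_spine, extend_spine]
  simp only [armFlux, Fin.val_castSucc, Fin.val_succ, Nat.cast_add, Nat.cast_one, freeVal_add_one]
  ring

/-- The condition that the extension has the prescribed cell sum on the central cells. -/
def IsBalanced (X : CellSystem Q) (t : K) (f : X.Vertex → K) (b : X.Cell → Q → K) : Prop :=
  ∀ w i, (t + Fintype.card Q - 1) * freeVal t (f (X.corner w i)) (b w i) (L + 1) =
    ∑ k, spineVal t (f (X.corner w k)) (b w k) (L + 1)

variable {t f b} in
theorem form_extend (h : IsBalanced L X t f b) :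
    (X.refine L hopp).form (t + Fintype.card Q - 1) (X.extend L hopp t (f, b)) g =
      ∑ w, ∑ i, (t + Fintype.card Q - 1) * (b w i - f (X.corner w i)) *
        g (Sum.inl (X.corner w i)) := by
  rw [form_apply, Fintype.sum_prod_type]
  refine Finset.sum_congr rfl fun w _ => ?_
  rw [Fintype.sum_option, Fintype.sum_prod_type, ← Finset.sum_add_distrib]
  refine Finset.sum_congr rfl fun i _ => ?_
  have hfirst : armFlux L hopp X t f b w i g 0 =
      (t + Fintype.card Q - 1) * (b w i - f (X.corner w i)) * g (Sum.inl (X.corner w i)) := by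
    simp [armFlux, spineVal_zero, freeVal_zero, spine]
  have hlast : armFlux L hopp X t f b w i g (Fin.last _) =
      ((X.refine L hopp).cellSum K (w, none) (X.extend L hopp t (f, b)) -
        (t + Fintype.card Q - 1) *
          X.extend L hopp t (f, b) ((X.refine L hopp).corner (w, none) i)) *
        g ((X.refine L hopp).corner (w, none) i) := by
    rw [cellSum_extend_center, ← h w i, refine_corner_none, extend_spine, armFlux]
    simp only [Fin.val_last, Nat.cast_add, Nat.cast_one]
    ring
  rw [Finset.sum_congr rfl fun j _ => form_extend_arm_cell L hopp X t f b w i g j,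
    Finset.sum_sub_distrib, ← hlast, ← hfirst]
  linear_combination Fin.sum_univ_succ (armFlux L hopp X t f b w i g) -
    Fin.sum_univ_castSucc (armFlux L hopp X t f b w i g)

variable {X t f b} in
theorem extend_mem_eigenspace (hf : f ∈ X.dirichlet K) (h : IsBalanced L X t f b)
    (hb : ∀ g ∈ X.dirichlet K, ∑ w, ∑ i, (b w i - f (X.corner w i)) * g (X.corner w i) = 0) :
    X.extend L hopp t (f, b) ∈ (X.refine L hopp).eigenspace (t + Fintype.card Q - 1) := by
  refine mem_eigenspace.2 ⟨mem_dirichlet.2 fun a => mem_dirichlet.1 hf a, fun g hg => ?_⟩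
  rw [form_extend L hopp X g h]
  simp only [mul_assoc, ← Finset.mul_sum]
  rw [hb (fun v => g (Sum.inl v)) (mem_dirichlet.2 fun a => mem_dirichlet.1 hg a), mul_zero]

theorem exists_extend_eq (hQ : 3 ≤ Fintype.card Q) :
    ∃ v, ∀ (f : X.Vertex → K) (b : X.Cell → Q → K), X.extend L hopp t (f, b) v = b w i := by
  have hQ' : 3 ≤ ENat.card Q := by simpa using mod_cast hQ
  obtain ⟨a, hi, ha⟩ := ENat.exists_ne_ne_of_three_le hQ' i (opp i)
  refine ⟨(X.refine L hopp).corner (w, some (i, 0)) a, fun f b => ?_⟩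
  rw [extend_corner_of_ne L hopp X t f b w i 0 hi ha]
  exact freeVal_zero ..

end Extend

section Nonresonant

variable [Field K] [Fintype Q] (L : ℕ) (X : CellSystem Q) (t : K)

/-- `T_n(t) + (P - 1) T_{n-1}(t)` for `n = L + 2`, in terms of Chebyshev polynomials of the second
kind. -/
def evalS (P t : K) : K :=
  t * evalU t (L + 1) - evalU t L + (P - 1) * (evalU t (L + 1) - t * evalU t L)

/-- The values at the free vertices of the outermost cells of the arms for which the extension of a
function is balanced, provided that `U_{L+1}(t) + U_L(t)` and `S` do not vanish. -/
def balancedVal : (X.Vertex → K) →ₗ[K] X.Cell → Q → K :=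
  LinearMap.pi fun w => LinearMap.pi fun i => (evalU t (L + 1) + evalU t L)⁻¹ •
    ((evalS L (Fintype.card Q : K) t)⁻¹ • X.cellSum K w +
      (2 * evalU t L) • LinearMap.proj (X.corner w i))

theorem balancedVal_apply (f : X.Vertex → K) (w : X.Cell) (i : Q) : balancedVal L X t f w i =
    (X.cellSum K w f / evalS L (Fintype.card Q : K) t + 2 * evalU t L * f (X.corner w i)) /
      (evalU t (L + 1) + evalU t L) := by
  simp [balancedVal, div_eq_inv_mul, mul_add]

variable {L t} (hA : evalU t (L + 1) + evalU t L ≠ 0)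

include hA in
theorem freeVal_balancedVal (f : X.Vertex → K) (w : X.Cell) (i : Q) :
    freeVal t (f (X.corner w i)) (balancedVal L X t f w i) (L + 1) =
      X.cellSum K w f / evalS L (Fintype.card Q : K) t := by
  rw [freeVal, add_sub_cancel_right, balancedVal_apply]
  field_simp
  ring

variable (hS : evalS L (Fintype.card Q : K) t ≠ 0)

include hA hS

theorem spineVal_balancedVal (f : X.Vertex → K) (w : X.Cell) (i : Q) :
    spineVal t (f (X.corner w i)) (balancedVal L X t f w i) (L + 1) =
      (t + 1) * evalU t L / ((evalU t (L + 1) + evalU t L) * evalS L (Fintype.card Q : K) t) *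
        X.cellSum K w f + 1 / (evalU t (L + 1) + evalU t L) * f (X.corner w i) := by
  rw [spineVal, add_sub_cancel_right, show (L : ℤ) + 1 - 2 = L - 1 by ring, evalU_sub_one,
    balancedVal_apply]
  field_simp
  linear_combination
    evalS L (Fintype.card Q : K) t * f (X.corner w i) * evalU_sq_add_evalU_sq t L

theorem isBalanced_balancedVal (f : X.Vertex → K) : IsBalanced L X t f (balancedVal L X t f) := by
  intro w i
  rw [freeVal_balancedVal X hA,
    Finset.sum_congr rfl fun k _ => spineVal_balancedVal X hA hS f w k, Finset.sum_add_distrib,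
    Finset.sum_const, ← Finset.mul_sum, ← cellSum_apply, Finset.card_univ, nsmul_eq_mul]
  have hS' : evalS L (Fintype.card Q : K) t = (t + Fintype.card Q - 1) *
      (evalU t (L + 1) + evalU t L) - Fintype.card Q * (t + 1) * evalU t L := by
    rw [evalS]; ring
  field_simp
  linear_combination -X.cellSum K w f * hS'

theorem balancedVal_sub (f : X.Vertex → K) (w : X.Cell) (i : Q) :
    balancedVal L X t f w i - f (X.corner w i) =
      1 / (evalS L (Fintype.card Q : K) t * (evalU t (L + 1) + evalU t L)) * (X.cellSum K w f -
        evalS L (Fintype.card Q : K) t * (evalU t (L + 1) - evalU t L) * f (X.corner w i)) := by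
  rw [balancedVal_apply]
  field_simp
  ring

variable [DecidableEq Q] {opp : Q → Q} (hopp : ∀ i, opp i ≠ i)

theorem extend_balancedVal_mem {f : X.Vertex → K} (hf : f ∈ X.eigenspace
      (evalS L (Fintype.card Q : K) t * (evalU t (L + 1) - evalU t L))) :
    X.extend L hopp t (f, balancedVal L X t f) ∈
      (X.refine L hopp).eigenspace (t + Fintype.card Q - 1) := by
  obtain ⟨hf, hform⟩ := mem_eigenspace.1 hf
  refine extend_mem_eigenspace L hopp hf (isBalanced_balancedVal X hA hS f) fun g hg => ?_
  simp only [balancedVal_sub X hA hS, mul_assoc _ (_ - _) (g _), ← Finset.mul_sum]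
  rw [← form_apply, hform g hg, mul_zero]

theorem finrank_eigenspace_le_refine :
    finrank K (X.eigenspace (evalS L (Fintype.card Q : K) t * (evalU t (L + 1) - evalU t L))) ≤
      finrank K ((X.refine L hopp).eigenspace (t + Fintype.card Q - 1)) := by
  let Φ := (X.extend L hopp t ∘ₗ LinearMap.id.prod (balancedVal L X t)).restrict
    fun _ hf => extend_balancedVal_mem X hA hS hopp hf
  refine LinearMap.finrank_le_finrank_of_injective (f := Φ) fun f f' h => ?_
  ext v
  exact congrFun (congrArg Subtype.val h) (Sum.inl v)

end Nonresonant

section Resonant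

variable [Field K] [Fintype Q] (X : CellSystem Q)

variable (K) in
theorem card_vertex_le_finrank_eigenspace_zero : Fintype.card X.Vertex ≤
    finrank K (X.eigenspace (0 : K)) + Fintype.card Q + Fintype.card X.Cell := by
  let Φ : (X.Vertex → K) →ₗ[K] (Q → K) × (X.Cell → K) :=
    (LinearMap.pi fun a => LinearMap.proj (X.bdry a)).prod (LinearMap.pi fun w => X.cellSum K w)
  have hker : LinearMap.ker Φ ≤ X.eigenspace 0 := fun f hf => by
    have hbdry : ∀ a, f (X.bdry a) = 0 := fun a => congrFun (congrArg Prod.fst hf) a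
    have hsum : ∀ w, X.cellSum K w f = 0 := fun w => congrFun (congrArg Prod.snd hf) w
    exact mem_eigenspace.2 ⟨mem_dirichlet.2 hbdry, fun g _ => by simp [form_apply, hsum]⟩
  have hrank := Φ.finrank_range_add_finrank_ker
  have hrange := Submodule.finrank_le (LinearMap.range Φ)
  have hmono := Submodule.finrank_mono hker
  simp only [Module.finrank_prod, Module.finrank_fintype_fun_eq_card] at hrank hrange
  omega

/-- The vertices that are not on the boundary. -/
abbrev Interior : Type u := {v : X.Vertex // v ∉ Set.range X.bdry}

open Classical in
variable (K) in
/-- The total of a function on the corners of all cells, over each cell and at each interior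
vertex. -/
def flux : (X.Cell → Q → K) →ₗ[K] (X.Cell → K) × (X.Interior → K) :=
  (LinearMap.pi fun w => ∑ a, LinearMap.proj a ∘ₗ LinearMap.proj w).prod
    (LinearMap.pi fun v => ∑ w, ∑ a,
      if X.corner w a = v then LinearMap.proj a ∘ₗ LinearMap.proj w else 0)

variable {X} in
open Classical in
theorem mem_ker_flux {b : X.Cell → Q → K} : b ∈ LinearMap.ker (X.flux K) ↔
    (∀ w, ∑ a, b w a = 0) ∧
      ∀ v ∉ Set.range X.bdry, (∑ w, ∑ a, if X.corner w a = v then b w a else 0) = 0 := by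
  have hite : ∀ (v : X.Vertex) w a, (if X.corner w a = v then
      (LinearMap.proj a ∘ₗ LinearMap.proj w : (X.Cell → Q → K) →ₗ[K] K) else 0) b =
      if X.corner w a = v then b w a else 0 := fun v w a => by split_ifs <;> rfl
  simp [flux, funext_iff, LinearMap.sum_apply, hite]

theorem le_finrank_ker_flux (hX : Function.Injective X.bdry) :
    Fintype.card Q * Fintype.card X.Cell + Fintype.card Q ≤
      finrank K (LinearMap.ker (X.flux K)) + Fintype.card X.Cell + Fintype.card X.Vertex := by
  classical
  have hrank := (X.flux K).finrank_range_add_finrank_ker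
  have hrange := Submodule.finrank_le (LinearMap.range (X.flux K))
  have hcard : Fintype.card X.Interior = Fintype.card X.Vertex - Fintype.card Q := by
    rw [Fintype.card_subtype_compl]
    exact congrArg _ (Fintype.card_congr (Equiv.ofInjective _ hX)).symm
  have hle := Fintype.card_le_of_injective _ hX
  simp only [Module.finrank_prod, Module.finrank_fintype_fun_eq_card, Module.finrank_pi_fintype,
    Finset.sum_const, Finset.card_univ, smul_eq_mul, hcard] at hrank hrange
  rw [mul_comm (Fintype.card Q)]
  omega

variable {X} in
theorem sum_mul_eq_zero_of_mem_ker_flux {b : X.Cell → Q → K} (hb : b ∈ LinearMap.ker (X.flux K))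
    {g : X.Vertex → K} (hg : g ∈ X.dirichlet K) : ∑ w, ∑ i, b w i * g (X.corner w i) = 0 := by
  classical
  have hsplit : ∀ w i, b w i * g (X.corner w i) =
      ∑ v, (if X.corner w i = v then b w i else 0) * g v := fun w i => by simp
  simp_rw [hsplit]
  rw [Finset.sum_congr rfl fun w _ => Finset.sum_comm, Finset.sum_comm]
  refine Finset.sum_eq_zero fun v _ => ?_
  simp_rw [← Finset.sum_mul]
  by_cases hv : v ∈ Set.range X.bdry
  · obtain ⟨a, rfl⟩ := hv
    rw [mem_dirichlet.1 hg, mul_zero]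
  · rw [(mem_ker_flux.1 hb).2 v hv, zero_mul]

variable [DecidableEq Q] {L : ℕ} {opp : Q → Q} (hopp : ∀ i, opp i ≠ i) {t : K}

variable {X} in
theorem extend_zero_mem_of_mem_ker_flux (hA : evalU t (L + 1) + evalU t L = 0)
    {b : X.Cell → Q → K} (hb : b ∈ LinearMap.ker (X.flux K)) :
    X.extend L hopp t (0, b) ∈ (X.refine L hopp).eigenspace (t + Fintype.card Q - 1) := by
  refine extend_mem_eigenspace L hopp (zero_mem _) (fun w i => ?_) fun g hg => ?_
  · simp only [freeVal, spineVal, add_sub_cancel_right, hA, Pi.zero_apply, mul_zero, sub_zero,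
      zero_mul]
    rw [← Finset.mul_sum, (mem_ker_flux.1 hb).1, mul_zero]
  · simpa using sum_mul_eq_zero_of_mem_ker_flux hb hg

theorem le_finrank_eigenspace_refine_of_evalU_add_eq_zero (hQ : 3 ≤ Fintype.card Q)
    (hX : Function.Injective X.bdry) (hA : evalU t (L + 1) + evalU t L = 0) :
    Fintype.card Q * Fintype.card X.Cell + Fintype.card Q ≤
      finrank K ((X.refine L hopp).eigenspace (t + Fintype.card Q - 1)) +
        Fintype.card X.Cell + Fintype.card X.Vertex := by
  let Φ := (X.extend L hopp t ∘ₗ LinearMap.inr K _ _).restrict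
    fun _ hb => extend_zero_mem_of_mem_ker_flux hopp hA hb
  have hΦ : finrank K (LinearMap.ker (X.flux K)) ≤
      finrank K ((X.refine L hopp).eigenspace (t + Fintype.card Q - 1)) := by
    refine LinearMap.finrank_le_finrank_of_injective (f := Φ) fun b b' h => ?_
    ext w i
    obtain ⟨v, hv⟩ := exists_extend_eq L hopp X t w i hQ
    rw [← hv 0 b, ← hv 0 b']
    exact congrFun (congrArg Subtype.val h) v
  have := X.le_finrank_ker_flux (K := K) hX
  omega

/-- The system with a single cell all of whose corners are boundary vertices. -/
abbrev base (Q : Type u) [Fintype Q] : CellSystem Q where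
  Vertex := Q
  Cell := PUnit
  corner _ a := a
  bdry a := a

theorem one_le_finrank_eigenspace_refine_base (hQ : 3 ≤ Fintype.card Q)
    (hS : evalS L (Fintype.card Q : K) t = 0) :
    1 ≤ finrank K (((base Q).refine L hopp).eigenspace (t + Fintype.card Q - 1)) := by
  have hmem : (base Q).extend L hopp t (0, 1) ∈
      ((base Q).refine L hopp).eigenspace (t + Fintype.card Q - 1) := by
    refine extend_mem_eigenspace L hopp (zero_mem _) (fun w i => ?_) fun g hg => ?_
    · simp only [freeVal, spineVal, add_sub_cancel_right, Pi.zero_apply, Pi.one_apply, mul_zero,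
        sub_zero, mul_one, Finset.sum_const, Finset.card_univ, nsmul_eq_mul]
      rw [evalS] at hS
      linear_combination hS
    · exact Finset.sum_eq_zero fun w _ => Finset.sum_eq_zero fun i _ => by
        rw [show g ((base Q).corner w i) = 0 from mem_dirichlet.1 hg i, mul_zero]
  obtain ⟨i⟩ : Nonempty Q := Fintype.card_pos_iff.mp (by omega)
  obtain ⟨v, hv⟩ := exists_extend_eq L hopp (base Q) t PUnit.unit i hQ
  refine Submodule.one_le_finrank_iff.2 fun hbot => one_ne_zero (α := K) ?_
  rw [hbot, Submodule.mem_bot] at hmem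
  exact (hv 0 1).symm.trans (congrFun hmem v)

end Resonant

end CellSystem

section Position

variable {L d : ℕ}

/-- The corner opposite to `a`. -/
def opp (a : Fin d → Bool) : Fin d → Bool := fun k => !a k

theorem opp_ne [NeZero d] (a : Fin d → Bool) : opp a ≠ a := fun h => by
  simpa [opp] using congrFun h 0

/-- The integer coordinates of a corner of the unit cube. -/
def bit (a : Fin d → Bool) (k : Fin d) : ℤ := if a k then 1 else 0

theorem bit_injective : Function.Injective (bit (d := d)) := fun a b h => by
  funext k
  have hk := congrFun h k
  grind [bit]

/-- The subcells of a cell for `n = L + 2`, indexed as in `CellSystem.refine`. -/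
abbrev Subcell (L d : ℕ) : Type := Option ((Fin d → Bool) × Fin (L + 1))

/-- The position of a subcell in a cube of side `2 L + 3`. -/
def digit : Subcell L d → Fin d → ℤ
  | none, _ => L + 1
  | some (i, j), k => if i k then 2 * L + 2 - j else j

theorem digit_nonneg (σ : Subcell L d) (k : Fin d) : 0 ≤ digit σ k := by
  rcases σ with _ | ⟨i, j⟩ <;> grind [digit]

theorem digit_lt (σ : Subcell L d) (k : Fin d) : digit σ k < 2 * L + 3 := by
  rcases σ with _ | ⟨i, j⟩ <;> grind [digit]

theorem digit_emod_two (σ : Subcell L d) (k k' : Fin d) : digit σ k % 2 = digit σ k' % 2 := by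
  rcases σ with _ | ⟨i, j⟩ <;> grind [digit]

theorem digit_injective [NeZero d] : Function.Injective (digit (L := L) (d := d)) := by
  rintro (_ | ⟨i, j⟩) (_ | ⟨i', j'⟩) h
  · rfl
  · have h0 := congrFun h 0
    grind [digit]
  · have h0 := congrFun h 0
    grind [digit]
  · have hi : i = i' := funext fun k => by
      have hk := congrFun h k
      grind [digit]
    have h0 := congrFun h 0
    grind [digit]

theorem digit_add_bit_injective {i i' a a' : Fin d → Bool} {j j' : Fin (L + 1)} (ha : a ≠ i)
    (ha' : a' ≠ i') (h : digit (some (i, j)) + bit a = digit (some (i', j')) + bit a') :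
    i = i' ∧ j = j' ∧ a = a' := by
  have hcoord : ∀ k, digit (some (i, j)) k + bit a k = digit (some (i', j')) k + bit a' k :=
    congrFun h
  have hi : i = i' := funext fun k => by
    have hk := hcoord k
    grind [digit, bit]
  subst hi
  have hj : j = j' := by
    by_contra hne
    rcases lt_or_gt_of_ne hne with hlt | hlt
    · refine ha' (funext fun k => ?_)
      have hk := hcoord k
      grind [digit, bit]
    · refine ha (funext fun k => ?_)
      have hk := hcoord k
      grind [digit, bit]
  subst hj
  exact ⟨rfl, rfl, bit_injective (add_left_cancel h)⟩

theorem eq_of_mul_add_eq {x y δ ε : ℤ} (hδ : 0 ≤ δ) (hδ' : δ < 2 * L + 3) (hε : 0 ≤ ε)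
    (hε' : ε < 2 * L + 3) (h : (2 * L + 3) * x + δ = (2 * L + 3) * y + ε) : x = y := by
  have hdiv : ∀ {x δ : ℤ}, 0 ≤ δ → δ < 2 * L + 3 →
      ((2 * L + 3) * x + δ) / (2 * L + 3) = x := fun hδ hδ' => by
    rw [add_comm, Int.add_mul_ediv_left _ _ (by omega), Int.ediv_eq_zero_of_lt hδ hδ', zero_add]
  exact (hdiv hδ hδ').symm.trans ((congrArg (· / (2 * (L : ℤ) + 3)) h).trans (hdiv hε hε'))

variable (L d) [NeZero d]

/-- The combinatorial model of the level-`m` graph for `n = L + 2`. -/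
def level : ℕ → CellSystem (Fin d → Bool)
  | 0 => .base _
  | m + 1 => (level m).refine L opp_ne

/-- The position of a cell of level `m` in the cube of side `(2 L + 3) ^ m`. -/
def off : (m : ℕ) → (level L d m).Cell → Fin d → ℤ
  | 0, _ => 0
  | m + 1, (w, σ) => (2 * L + 3 : ℤ) • off m w + digit σ

/-- The position of a vertex of level `m` in the cube of side `(2 L + 3) ^ m`. -/
def pos : (m : ℕ) → (level L d m).Vertex → Fin d → ℤ
  | 0, a => bit a
  | m + 1, Sum.inl v => (2 * L + 3 : ℤ) • pos m v
  | m + 1, Sum.inr (w, ⟨(i, j, a), _⟩) =>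
      (2 * L + 3 : ℤ) • off L d m w + digit (some (i, j)) + bit a

variable (m : ℕ)

theorem off_succ (w : (level L d m).Cell) (σ : Subcell L d) (k : Fin d) :
    off L d (m + 1) (w, σ) k = (2 * L + 3) * off L d m w k + digit σ k :=
  rfl

theorem pos_succ_inl (v : (level L d m).Vertex) (k : Fin d) :
    pos L d (m + 1) (Sum.inl v) k = (2 * L + 3) * pos L d m v k :=
  rfl

theorem pos_succ_inr (w : (level L d m).Cell) (i a : Fin d → Bool) (j : Fin (L + 1)) (h : a ≠ i)
    (k : Fin d) : pos L d (m + 1) (Sum.inr (w, ⟨(i, j, a), h⟩)) k =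
      (2 * L + 3) * off L d m w k + digit (some (i, j)) k + bit a k :=
  rfl

theorem pos_spine (w : (level L d m).Cell) (i : Fin d → Bool)
    (hw : pos L d m ((level L d m).corner w i) = off L d m w + bit i) (j : Fin (L + 2))
    (k : Fin d) : pos L d (m + 1) ((level L d m).spine opp_ne w i j) k =
      (2 * L + 3) * off L d m w k + (if i k then 2 * L + 3 - (j : ℤ) else j) := by
  cases j using Fin.cases with
  | zero =>
    refine (pos_succ_inl L d m _ k).trans ?_
    rw [hw, Pi.add_apply, Fin.val_zero]
    grind [bit]
  | succ j =>
    refine (pos_succ_inr L d m w i (opp i) j (opp_ne i) k).trans ?_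
    grind [digit, bit, opp]

theorem pos_corner (w : (level L d m).Cell) (a : Fin d → Bool) :
    pos L d m ((level L d m).corner w a) = off L d m w + bit a := by
  induction m generalizing a with
  | zero => exact (zero_add (bit a)).symm
  | succ m ih =>
    obtain ⟨w, _ | ⟨i, j⟩⟩ := w
    · funext k
      refine (pos_spine L d m w a (ih w a) (Fin.last _) k).trans ?_
      rw [Pi.add_apply, off_succ]
      grind [digit, bit]
    · by_cases h : a = i
      · subst h
        funext k
        refine (congrArg (pos L d (m + 1) · k)
          ((level L d m).refine_corner_self L opp_ne w a j)).trans ?_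
        rw [pos_spine L d m w a (ih w a), Pi.add_apply, off_succ]
        grind [digit, bit]
      · exact congrArg (pos L d (m + 1)) ((level L d m).refine_corner_of_ne L opp_ne w i j h)

theorem pos_bdry (a : Fin d → Bool) :
    pos L d m ((level L d m).bdry a) = (2 * L + 3 : ℤ) ^ m • bit a := by
  induction m with
  | zero => exact (one_smul _ _).symm
  | succ m ih =>
    refine (congrArg ((2 * L + 3 : ℤ) • ·) ih).trans ?_
    rw [smul_smul, pow_succ']

theorem off_emod_two (w : (level L d m).Cell) (k k' : Fin d) :
    off L d m w k % 2 = off L d m w k' % 2 := by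
  induction m with
  | zero => rfl
  | succ m ih =>
    obtain ⟨w, σ⟩ := w
    simp only [off_succ, Int.add_emod _ (digit σ _), Int.mul_emod _ (off L d m w _), ih w,
      digit_emod_two σ k k']

theorem off_injective : Function.Injective (off L d m) := by
  induction m with
  | zero => exact fun _ _ _ => rfl
  | succ m ih =>
    rintro ⟨w, σ⟩ ⟨w', σ'⟩ h
    have hw : off L d m w = off L d m w' := funext fun k =>
      eq_of_mul_add_eq (digit_nonneg σ k) (digit_lt σ k) (digit_nonneg σ' k) (digit_lt σ' k)
        (congrFun h k)
    have hσ : digit σ = digit σ' := funext fun k => by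
      have hk := congrFun h k
      rw [off_succ, off_succ, hw] at hk
      exact add_left_cancel hk
    rw [ih hw, digit_injective hσ]

theorem eq_or_forall_abs_off_sub_eq_one {w w' : (level L d m).Cell}
    (h : ∀ k, |off L d m w k - off L d m w' k| ≤ 1) :
    w = w' ∨ ∀ k, |off L d m w k - off L d m w' k| = 1 := by
  by_cases hne : ∀ k, off L d m w k ≠ off L d m w' k
  · exact Or.inr fun k => le_antisymm (h k) (Int.one_le_abs (sub_ne_zero.2 (hne k)))
  · push Not at hne
    obtain ⟨k₀, hk₀⟩ := hne
    refine Or.inl (off_injective L d m (funext fun k => ?_))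
    have hw := off_emod_two L d m w k k₀
    have hw' := off_emod_two L d m w' k k₀
    have hk := abs_le.1 (h k)
    omega

theorem eq_of_off_add_bit_eq {w w' : (level L d m).Cell} {a a' b b' : Fin d → Bool} (hab : a ≠ b)
    (ha : off L d m w + bit a = off L d m w' + bit a')
    (hb : off L d m w + bit b = off L d m w' + bit b') : w = w' ∧ a = a' ∧ b = b' := by
  have ha_coord : ∀ k, off L d m w k + bit a k = off L d m w' k + bit a' k := congrFun ha
  have hb_coord : ∀ k, off L d m w k + bit b k = off L d m w' k + bit b' k := congrFun hb
  have hle : ∀ k, |off L d m w k - off L d m w' k| ≤ 1 := fun k => by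
    have := ha_coord k
    grind [bit]
  rcases eq_or_forall_abs_off_sub_eq_one L d m hle with rfl | h
  · exact ⟨rfl, bit_injective (add_left_cancel ha), bit_injective (add_left_cancel hb)⟩
  · refine absurd (funext fun k => ?_) hab
    have hk := h k
    have := ha_coord k
    have := hb_coord k
    grind [bit]

theorem exists_corner_eq (v : (level L d m).Vertex) : ∃ w a, (level L d m).corner w a = v := by
  induction m with
  | zero => exact ⟨PUnit.unit, v, rfl⟩
  | succ m ih =>
    rcases v with v | ⟨w, ⟨⟨i, j, a⟩, h⟩⟩
    · obtain ⟨w, a, rfl⟩ := ih v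
      exact ⟨(w, some (a, 0)), a, (level L d m).refine_corner_self L opp_ne w a 0⟩
    · exact ⟨(w, some (i, j)), a, (level L d m).refine_corner_of_ne L opp_ne w i j h⟩

variable {L d m}

theorem eq_of_newVertex_pos_eq {w w' : (level L d m).Cell} {i a : Fin d → Bool}
    {j : Fin (L + 1)} (ha : a ≠ i) {ε : Fin d → ℤ} (hε : ∀ k, 0 ≤ ε k ∧ ε k ≤ 2 * L + 3)
    (h : ∀ k, (2 * L + 3) * off L d m w k + digit (some (i, j)) k + bit a k =
      (2 * L + 3) * off L d m w' k + ε k) : w = w' := by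
  have hbounds : ∀ k, 0 ≤ digit (some (i, j)) k + bit a k ∧
      digit (some (i, j)) k + bit a k ≤ 2 * L + 3 := fun k => by
    have := digit_nonneg (some (i, j)) k
    have := digit_lt (some (i, j)) k
    grind [bit]
  refine (eq_or_forall_abs_off_sub_eq_one L d m fun k => ?_).resolve_right fun hone =>
    ha (funext fun k => ?_)
  · have hk := h k
    have hδ := hbounds k
    have hεk := hε k
    rw [abs_le]
    constructor <;> nlinarith
  · have hk := h k
    have hδ := hbounds k
    have hεk := hε k
    have hextreme : digit (some (i, j)) k + bit a k = 0 ∨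
        digit (some (i, j)) k + bit a k = 2 * L + 3 :=
      (eq_or_eq_neg_of_abs_eq (hone k)).imp (fun e => by nlinarith) fun e => by nlinarith
    grind [digit, bit]

theorem pos_succ_inl_ne_inr (v : (level L d m).Vertex) (w : (level L d m).Cell)
    (p : CellSystem.NewVertex (Fin d → Bool) L) :
    pos L d (m + 1) (Sum.inl v) ≠ pos L d (m + 1) (Sum.inr (w, p)) := by
  obtain ⟨⟨i, j, a⟩, ha : a ≠ i⟩ := p
  intro h
  obtain ⟨w', b, rfl⟩ := exists_corner_eq L d m v
  have hcoord : ∀ k, (2 * L + 3) * off L d m w k + digit (some (i, j)) k + bit a k =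
      (2 * L + 3) * off L d m w' k + (2 * L + 3) * bit b k := fun k => by
    have hk := congrFun h k
    rw [pos_succ_inl, pos_succ_inr, pos_corner, Pi.add_apply] at hk
    linear_combination -hk
  obtain rfl : w = w' := eq_of_newVertex_pos_eq ha (fun k => by grind [bit]) hcoord
  refine ha (funext fun k => ?_)
  have hk := hcoord k
  grind [digit, bit]

theorem pos_injective : Function.Injective (pos L d m) := by
  induction m with
  | zero => exact bit_injective
  | succ m ih =>
    rintro (v | ⟨w, ⟨⟨i, j, a⟩, ha⟩⟩) (v' | ⟨w', ⟨⟨i', j', a'⟩, ha'⟩⟩) h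
    · exact congrArg Sum.inl (ih (smul_right_injective _ (by positivity) h))
    · exact absurd h (pos_succ_inl_ne_inr v w' _)
    · exact absurd h.symm (pos_succ_inl_ne_inr v' w _)
    · have hcoord : ∀ k, (2 * L + 3) * off L d m w k + digit (some (i, j)) k + bit a k =
          (2 * L + 3) * off L d m w' k + (digit (some (i', j')) k + bit a' k) := fun k =>
        (congrFun h k).trans (add_assoc _ _ _)
      obtain rfl : w = w' := eq_of_newVertex_pos_eq ha (fun k => by
        have := digit_nonneg (some (i', j')) k
        have := digit_lt (some (i', j')) k
        grind [bit]) hcoord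
      obtain ⟨rfl, rfl, rfl⟩ := digit_add_bit_injective ha ha' (funext fun k =>
        add_left_cancel ((add_assoc _ _ _).symm.trans (hcoord k)))
      rfl

end Position

namespace CellSystem

section Graph

variable {K Q : Type*} (X : CellSystem Q)

/-- The corners of each cell are distinct, and two cells have at most one corner in common. -/
def IsProper : Prop :=
  ∀ ⦃w w' a a' b b'⦄, a ≠ b → X.corner w a = X.corner w' a' → X.corner w b = X.corner w' b' →
    w = w' ∧ a = a' ∧ b = b'

variable {X} in
theorem IsProper.corner_injective (hX : X.IsProper) (w : X.Cell) :
    Function.Injective (X.corner w) := fun a b h => by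
  by_contra hab
  exact hab (hX hab h h.symm).2.1

/-- The graph on the vertices in which the corners of each cell are joined to each other. -/
def graph : SimpleGraph X.Vertex where
  Adj v v' := v ≠ v' ∧ ∃ w a b, X.corner w a = v ∧ X.corner w b = v'
  symm := ⟨fun _ _ ⟨hne, w, a, b, ha, hb⟩ => ⟨hne.symm, w, b, a, hb, ha⟩⟩
  loopless := ⟨fun _ h => h.1 rfl⟩

variable {X}

theorem graph_adj (hX : X.IsProper) {v v' : X.Vertex} :
    X.graph.Adj v v' ↔ ∃ w a b, a ≠ b ∧ X.corner w a = v ∧ X.corner w b = v' := by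
  constructor
  · rintro ⟨hne, w, a, b, rfl, rfl⟩
    exact ⟨w, a, b, fun h => hne (congrArg _ h), rfl, rfl⟩
  · rintro ⟨w, a, b, hab, rfl, rfl⟩
    exact ⟨fun h => hab (hX.corner_injective w h), w, a, b, rfl, rfl⟩

variable [Fintype Q]

open Classical in
theorem sum_neighborFinset {M : Type*} [AddCommMonoid M] (hX : X.IsProper) (v : X.Vertex)
    (h : X.Vertex → M) : ∑ y ∈ X.graph.neighborFinset v, h y =
      ∑ w, ∑ a, if X.corner w a = v then ∑ b ∈ Finset.univ.erase a, h (X.corner w b) else 0 := by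
  have hincidences : ∑ p : X.Cell × Q × Q with p.2.1 ≠ p.2.2 ∧ X.corner p.1 p.2.1 = v,
      h (X.corner p.1 p.2.2) = ∑ y ∈ X.graph.neighborFinset v, h y := by
    refine Finset.sum_bij (fun p _ => X.corner p.1 p.2.2) ?_ ?_ ?_ fun _ _ => rfl
    · rintro ⟨w, a, b⟩ hp
      obtain ⟨hab, ha⟩ := (Finset.mem_filter.1 hp).2
      exact (X.graph.mem_neighborFinset _ _).2 ((graph_adj hX).2 ⟨w, a, b, hab, ha, rfl⟩)
    · rintro ⟨w, a, b⟩ hp ⟨w', a', b'⟩ hp' hb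
      obtain ⟨hab, ha⟩ := (Finset.mem_filter.1 hp).2
      obtain ⟨-, ha'⟩ := (Finset.mem_filter.1 hp').2
      obtain ⟨rfl, rfl, rfl⟩ := hX hab (ha.trans ha'.symm) hb
      rfl
    · intro y hy
      obtain ⟨w, a, b, hab, ha, hb⟩ := (graph_adj hX).1 ((X.graph.mem_neighborFinset _ _).1 hy)
      exact ⟨(w, a, b), Finset.mem_filter.2 ⟨Finset.mem_univ _, hab, ha⟩, hb⟩
  rw [← hincidences, Finset.sum_filter, Fintype.sum_prod_type]
  refine Finset.sum_congr rfl fun w _ => ?_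
  rw [Fintype.sum_prod_type]
  refine Finset.sum_congr rfl fun a _ => ?_
  split_ifs with ha
  · rw [← Finset.filter_ne, Finset.sum_filter]
    simp [ha]
  · simp [ha]

variable [CommRing K]

open Classical in
theorem form_single (hX : X.IsProper) (lam : K) (f : X.Vertex → K) (v : X.Vertex) :
    X.form (Fintype.card Q - (Fintype.card Q - 1) * lam) f (Pi.single v 1) =
      ∑ y ∈ X.graph.neighborFinset v, (f y - (1 - lam) * f v) := by
  rw [sum_neighborFinset hX, form_apply]
  refine Finset.sum_congr rfl fun w _ => Finset.sum_congr rfl fun a _ => ?_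
  split_ifs with ha
  · have hcard : ((Finset.univ.erase a).card : K) = Fintype.card Q - 1 := by
      rw [Finset.card_erase_of_mem (Finset.mem_univ a), Finset.card_univ,
        Nat.cast_sub (Fintype.card_pos_iff.2 ⟨a⟩), Nat.cast_one]
    rw [ha, Pi.single_eq_same, cellSum_apply, ← Finset.add_sum_erase _ _ (Finset.mem_univ a),
      Finset.sum_sub_distrib, Finset.sum_const, nsmul_eq_mul, hcard, ha]
    ring
  · rw [Pi.single_eq_of_ne ha, mul_zero]

open Classical in
theorem mem_eigenspace_iff_form_single {s : K} {f : X.Vertex → K} : f ∈ X.eigenspace s ↔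
    f ∈ X.dirichlet K ∧ ∀ v ∉ Set.range X.bdry, X.form s f (Pi.single v 1) = 0 := by
  rw [mem_eigenspace]
  refine and_congr_right fun _ => ⟨fun h v hv => h _ ?_, fun h g hg => ?_⟩
  · exact mem_dirichlet.2 fun a => Pi.single_eq_of_ne (fun e => hv ⟨a, e⟩) _
  · rw [LinearMap.pi_apply_eq_sum_univ (X.form s f) g]
    refine Finset.sum_eq_zero fun v _ => ?_
    by_cases hv : v ∈ Set.range X.bdry
    · obtain ⟨a, rfl⟩ := hv
      rw [mem_dirichlet.1 hg, zero_smul]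
    · have hsingle : (fun v' => if v = v' then (1 : K) else 0) = Pi.single v 1 :=
        funext fun v' => by simp [Pi.single_apply, eq_comm]
      rw [hsingle, h v hv, smul_zero]

end Graph

end CellSystem

section Realization

open Module

variable (L d : ℕ)

/-- The translation and scaling that maps the unit cube onto its subcell `σ`. -/
def placement (σ : Subcell L d) (x : Fin d → ℝ) : Fin d → ℝ :=
  fun k => (x k + digit σ k) / (2 * L + 3)

variable {L d}

theorem contraction_eq_placement_none (i : Fin d → Bool) :
    contraction (L + 2) i (L + 2) = placement L d none := by
  funext x k
  have hL : (L : ℝ) + 2 - 1 = L + 1 := by ring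
  have hN : 2 * ((L : ℝ) + 2) - 1 = 2 * L + 3 := by ring
  simp only [contraction, placement, digit, center, Pi.add_apply, Pi.smul_apply, smul_eq_mul]
  push_cast
  rw [hN, hL, sub_self, zero_div, zero_mul, zero_add]
  field_simp
  ring

theorem contraction_eq_placement_some (i : Fin d → Bool) (j : Fin (L + 1)) :
    contraction (L + 2) i (j + 1) = placement L d (some (i, j)) := by
  funext x k
  have hL : (L : ℝ) + 2 - 1 = L + 1 := by ring
  have hN : 2 * ((L : ℝ) + 2) - 1 = 2 * L + 3 := by ring
  simp only [contraction, placement, digit, center, corner, Pi.add_apply, Pi.smul_apply,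
    smul_eq_mul]
  push_cast
  rw [hN, hL]
  split_ifs <;> field_simp <;> ring

theorem exists_contraction_iff {p : ((Fin d → ℝ) → Fin d → ℝ) → Prop} :
    (∃ i, ∃ j ∈ Finset.Icc 1 (L + 2), p (contraction (L + 2) i j)) ↔
      ∃ σ, p (placement L d σ) := by
  constructor
  · rintro ⟨i, j, hj, h⟩
    obtain ⟨hj, hjL⟩ := Finset.mem_Icc.1 hj
    obtain ⟨j, rfl⟩ := Nat.exists_eq_add_of_le' hj
    rcases (show j ≤ L + 1 by omega).eq_or_lt with rfl | hlt
    · exact ⟨none, contraction_eq_placement_none i ▸ h⟩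
    · exact ⟨some (i, ⟨j, hlt⟩), contraction_eq_placement_some i ⟨j, hlt⟩ ▸ h⟩
  · rintro ⟨_ | ⟨i, j⟩, h⟩
    · exact ⟨fun _ => true, L + 2, by simp, (contraction_eq_placement_none _).symm ▸ h⟩
    · exact ⟨i, j + 1, by simp, (contraction_eq_placement_some i j).symm ▸ h⟩

variable (L) in
/-- The point of the unit cube with integer coordinates `x` in the grid of level `m`. -/
def gridPoint (m : ℕ) (x : Fin d → ℤ) : Fin d → ℝ := fun k => x k / (2 * L + 3) ^ m

theorem gridPoint_injective (m : ℕ) : Function.Injective (gridPoint (d := d) L m) :=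
  fun x y h => funext fun k => by
    have hpow : (2 * L + 3 : ℝ) ^ m ≠ 0 := by positivity
    exact_mod_cast (div_left_inj' hpow).1 (congrFun h k)

theorem gridPoint_smul_bit (m : ℕ) (a : Fin d → Bool) :
    gridPoint L m ((2 * L + 3 : ℤ) ^ m • bit a) = corner a := by
  funext k
  have hpow : (2 * L + 3 : ℝ) ^ m ≠ 0 := by positivity
  by_cases h : a k <;> simp [gridPoint, corner, bit, hpow, h]

theorem placement_gridPoint (m : ℕ) (σ : Subcell L d) (x : Fin d → ℤ) :
    placement L d σ (gridPoint L m x) =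
      gridPoint L (m + 1) (x + (2 * L + 3 : ℤ) ^ m • digit σ) := by
  funext k
  simp only [placement, gridPoint, Pi.add_apply, Pi.smul_apply, smul_eq_mul]
  push_cast
  field_simp
  ring

variable [NeZero d] (m : ℕ)

theorem exists_off_succ_iff {p : (Fin d → ℤ) → Prop} :
    (∃ w, p (off L d (m + 1) w)) ↔
      ∃ w, ∃ σ : Subcell L d, p (off L d m w + (2 * L + 3 : ℤ) ^ m • digit σ) := by
  induction m generalizing p with
  | zero =>
    have hoff : ∀ σ : Subcell L d, off L d 1 (PUnit.unit, σ) =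
        off L d 0 PUnit.unit + (2 * L + 3 : ℤ) ^ 0 • digit σ := fun σ => by
      rw [pow_zero, one_smul]
      exact congrArg (· + digit σ) (smul_zero _)
    exact ⟨fun ⟨(_, σ), h⟩ => ⟨PUnit.unit, σ, hoff σ ▸ h⟩,
      fun ⟨_, σ, h⟩ => ⟨(PUnit.unit, σ), (hoff σ).symm ▸ h⟩⟩
  | succ m ih =>
    have hswap : ∀ (w : (level L d m).Cell) (σ σ' : Subcell L d),
        (2 * L + 3 : ℤ) • (off L d m w + (2 * L + 3 : ℤ) ^ m • digit σ) + digit σ' =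
          off L d (m + 1) (w, σ') + (2 * L + 3 : ℤ) ^ (m + 1) • digit σ := fun w σ σ' => by
      rw [smul_add, smul_smul, ← pow_succ', add_right_comm]
      rfl
    have hsplit := ih (p := fun x => ∃ σ' : Subcell L d, p ((2 * L + 3 : ℤ) • x + digit σ'))
    constructor
    · rintro ⟨⟨w, σ'⟩, h⟩
      obtain ⟨w, σ, σ', h⟩ := hsplit.1 ⟨w, σ', h⟩
      exact ⟨(w, σ'), σ, hswap w σ σ' ▸ h⟩
    · rintro ⟨⟨w, σ'⟩, σ, h⟩
      obtain ⟨w, σ', h⟩ := hsplit.2 ⟨w, σ, σ', (hswap w σ σ').symm ▸ h⟩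
      exact ⟨(w, σ'), h⟩

/-- The point of `V_m` at the corner `a` of a cell. -/
def cellCorner (w : (level L d m).Cell) (a : Fin d → Bool) : Fin d → ℝ :=
  gridPoint L m (off L d m w + bit a)

theorem gridPoint_pos_corner (w : (level L d m).Cell) (a : Fin d → Bool) :
    gridPoint L m (pos L d m ((level L d m).corner w a)) = cellCorner m w a := by
  rw [pos_corner, cellCorner]

theorem cellCorner_zero (w : (level L d 0).Cell) (a : Fin d → Bool) :
    cellCorner 0 w a = corner a := by
  rw [← gridPoint_smul_bit (L := L) 0 a, pow_zero, one_smul]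
  exact congrArg (gridPoint L 0) (zero_add (bit a))

theorem exists_cellCorner_succ_iff {p : ((Fin d → Bool) → Fin d → ℝ) → Prop} :
    (∃ w, p (cellCorner (L := L) (m + 1) w)) ↔ ∃ i, ∃ j ∈ Finset.Icc 1 (L + 2), ∃ w,
      p fun a => contraction (L + 2) i j (cellCorner (L := L) m w a) := by
  rw [exists_contraction_iff (p := fun φ => ∃ w, p fun a => φ (cellCorner (L := L) m w a)),
    exists_comm]
  refine (exists_off_succ_iff m (p := fun x => p fun a => gridPoint L (m + 1) (x + bit a))).trans
    (exists₂_congr fun w σ => ?_)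
  simp only [cellCorner, placement_gridPoint, add_right_comm]

theorem mem_vertices {x : Fin d → ℝ} :
    x ∈ vertices (L + 2) d m ↔ ∃ w a, cellCorner (L := L) m w a = x := by
  induction m generalizing x with
  | zero =>
    simp only [vertices, Finset.mem_image, Finset.mem_univ, true_and, cellCorner_zero]
    exact ⟨fun h => ⟨PUnit.unit, h⟩, fun ⟨_, h⟩ => h⟩
  | succ m ih =>
    rw [exists_cellCorner_succ_iff m (p := fun φ => ∃ a, φ a = x)]
    simp only [vertices, Finset.mem_biUnion, Finset.mem_univ, true_and, Finset.mem_image, ih]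
    refine exists₂_congr fun i j => and_congr_right fun _ => ?_
    constructor
    · rintro ⟨_, ⟨w, a, rfl⟩, h⟩
      exact ⟨w, a, h⟩
    · rintro ⟨w, a, h⟩
      exact ⟨_, ⟨w, a, rfl⟩, h⟩

theorem mem_edges {e : Sym2 (Fin d → ℝ)} : e ∈ edges (L + 2) d m ↔
    ∃ w a b, a ≠ b ∧ e = s(cellCorner (L := L) m w a, cellCorner m w b) := by
  induction m generalizing e with
  | zero =>
    simp only [edges, Set.mem_ofPred_eq, cellCorner_zero]
    exact ⟨fun h => ⟨PUnit.unit, h⟩, fun ⟨_, h⟩ => h⟩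
  | succ m ih =>
    rw [exists_cellCorner_succ_iff m (p := fun φ => ∃ a b, a ≠ b ∧ e = s(φ a, φ b))]
    simp only [edges, Set.mem_ofPred_eq, ih]
    refine exists₂_congr fun i j => and_congr_right fun _ => ?_
    constructor
    · rintro ⟨_, ⟨w, a, b, hab, rfl⟩, rfl⟩
      exact ⟨w, a, b, hab, rfl⟩
    · rintro ⟨w, a, b, hab, h⟩
      exact ⟨_, ⟨w, a, b, hab, rfl⟩, h⟩

end Realization

section Laplacian

open Module CellSystem

variable {L d : ℕ} [NeZero d] (m : ℕ)

theorem isProper_level : (level L d m).IsProper := fun _ _ _ _ _ _ hab ha hb => by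
  have hpos : ∀ {w w' a a'}, (level L d m).corner w a = (level L d m).corner w' a' →
      off L d m w + bit a = off L d m w' + bit a' := fun h => by
    rw [← pos_corner, ← pos_corner, h]
  exact eq_of_off_add_bit_eq L d m hab (hpos ha) (hpos hb)

theorem bdry_injective : Function.Injective (level L d m).bdry := fun a b h => by
  have hbit : (2 * L + 3 : ℤ) ^ m • bit a = (2 * L + 3 : ℤ) ^ m • bit b := by
    rw [← pos_bdry, ← pos_bdry, h]
  exact bit_injective (smul_right_injective _ (by positivity) hbit)

variable (L d)

theorem gridPoint_pos_injective : Function.Injective fun v => gridPoint L m (pos L d m v) :=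
  (gridPoint_injective m).comp pos_injective

theorem gridPoint_pos_mem (v : (level L d m).Vertex) :
    gridPoint L m (pos L d m v) ∈ vertices (L + 2) d m := by
  obtain ⟨w, a, rfl⟩ := exists_corner_eq L d m v
  exact (mem_vertices m).2 ⟨w, a, (gridPoint_pos_corner m w a).symm⟩

/-- The identification of the vertices of the combinatorial model with the points of `V_m`. -/
def vertexEquiv : (level L d m).Vertex ≃ vertices (L + 2) d m :=
  Equiv.ofBijective (fun v => ⟨gridPoint L m (pos L d m v), gridPoint_pos_mem L d m v⟩)
    ⟨fun _ _ h => gridPoint_pos_injective L d m (congrArg Subtype.val h), fun ⟨x, hx⟩ => by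
      obtain ⟨w, a, rfl⟩ := (mem_vertices m).1 hx
      exact ⟨(level L d m).corner w a, Subtype.ext (gridPoint_pos_corner m w a)⟩⟩

variable {L d}

theorem coe_vertexEquiv_corner (w : (level L d m).Cell) (a : Fin d → Bool) :
    (vertexEquiv L d m ((level L d m).corner w a) : Fin d → ℝ) = cellCorner m w a :=
  gridPoint_pos_corner m w a

theorem coe_vertexEquiv_bdry (a : Fin d → Bool) :
    (vertexEquiv L d m ((level L d m).bdry a) : Fin d → ℝ) = corner a :=
  (congrArg (gridPoint L m) (pos_bdry L d m a)).trans (gridPoint_smul_bit m a)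

theorem vertexEquiv_mem_boundary_iff (v : (level L d m).Vertex) :
    (vertexEquiv L d m v : Fin d → ℝ) ∈ vertices (L + 2) d 0 ↔
      v ∈ Set.range (level L d m).bdry := by
  simp only [vertices, Finset.mem_image, Finset.mem_univ, true_and, Set.mem_range]
  exact exists_congr fun a => by
    rw [← coe_vertexEquiv_bdry (L := L) m a, Subtype.coe_inj,
      (vertexEquiv L d m).apply_eq_iff_eq]

theorem graph_adj_vertexEquiv (v v' : (level L d m).Vertex) :
    (graph (L + 2) d m).Adj (vertexEquiv L d m v) (vertexEquiv L d m v') ↔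
      (level L d m).graph.Adj v v' := by
  rw [graph, SimpleGraph.comap_adj, SimpleGraph.fromEdgeSet_adj, mem_edges, Subtype.coe_ne_coe,
    (vertexEquiv L d m).apply_eq_iff_eq.ne, and_comm]
  refine and_congr_right fun hne => ?_
  simp only [Sym2.eq_iff, ← coe_vertexEquiv_corner m, Subtype.coe_inj,
    (vertexEquiv L d m).apply_eq_iff_eq]
  constructor
  · rintro ⟨w, a, b, -, ⟨rfl, rfl⟩ | ⟨rfl, rfl⟩⟩
    · exact ⟨w, a, b, rfl, rfl⟩
    · exact ⟨w, b, a, rfl, rfl⟩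
  · rintro ⟨w, a, b, rfl, rfl⟩
    exact ⟨w, a, b, fun h => hne (congrArg _ h), Or.inl ⟨rfl, rfl⟩⟩

open Classical in
theorem sum_neighborFinset_vertexEquiv (v : (level L d m).Vertex)
    (f : vertices (L + 2) d m → ℝ) :
    ∑ y ∈ (graph (L + 2) d m).neighborFinset (vertexEquiv L d m v), f y =
      ∑ y ∈ (level L d m).graph.neighborFinset v, f (vertexEquiv L d m y) :=
  (Finset.sum_equiv (vertexEquiv L d m) (fun y => by
    rw [SimpleGraph.mem_neighborFinset, SimpleGraph.mem_neighborFinset, graph_adj_vertexEquiv])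
    fun _ _ => rfl).symm

open Classical in
theorem neg_laplacian_eq_iff (lam : ℝ) (f : vertices (L + 2) d m → ℝ)
    (v : (level L d m).Vertex) :
    -laplacian (L + 2) d m f (vertexEquiv L d m v) = lam * f (vertexEquiv L d m v) ↔
      (level L d m).form (2 ^ d - (2 ^ d - 1) * lam) (f ∘ vertexEquiv L d m)
        (Pi.single v 1) = 0 := by
  have hdegree : ((graph (L + 2) d m).degree (vertexEquiv L d m v) : ℝ) ≠ 0 := by
    rw [Nat.cast_ne_zero, ← Nat.pos_iff_ne_zero, SimpleGraph.degree_pos_iff_exists_adj]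
    obtain ⟨w, a, rfl⟩ := exists_corner_eq L d m v
    exact ⟨vertexEquiv L d m ((level L d m).corner w (opp a)), (graph_adj_vertexEquiv m _ _).2
      ((graph_adj (isProper_level m)).2 ⟨w, a, opp a, (opp_ne a).symm, rfl, rfl⟩)⟩
  have hform := form_single (isProper_level m) lam (f ∘ vertexEquiv L d m) v
  simp only [Function.comp_apply, Fintype.card_pi, Fintype.card_bool, Finset.prod_const,
    Finset.card_univ, Fintype.card_fin, Nat.cast_pow, Nat.cast_ofNat] at hform
  rw [hform, ← sum_neighborFinset_vertexEquiv m v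
      fun y => f y - (1 - lam) * f (vertexEquiv L d m v),
    Finset.sum_sub_distrib, Finset.sum_const, nsmul_eq_mul,
    SimpleGraph.card_neighborFinset_eq_degree, laplacian]
  field_simp
  constructor <;> intro h <;> linear_combination -h

theorem mem_dirichletEigenspace_iff (lam : ℝ) (f : vertices (L + 2) d m → ℝ) :
    f ∈ dirichletEigenspace (L + 2) d m lam ↔
      f ∘ vertexEquiv L d m ∈ (level L d m).eigenspace (2 ^ d - (2 ^ d - 1) * lam) := by
  classical
  rw [mem_eigenspace_iff_form_single, mem_dirichlet]
  refine and_congr ((vertexEquiv L d m).forall_congr_right.symm.trans ?_)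
    ((vertexEquiv L d m).forall_congr_right.symm.trans (forall_congr' fun v => ?_))
  · simp only [vertexEquiv_mem_boundary_iff, Set.forall_mem_range, Function.comp_apply]
  · rw [vertexEquiv_mem_boundary_iff, neg_laplacian_eq_iff]

theorem dirichletMultiplicity_eq_finrank (lam : ℝ) : dirichletMultiplicity (L + 2) d m lam =
    finrank ℝ ((level L d m).eigenspace (2 ^ d - (2 ^ d - 1) * lam)) := by
  have hcomap : dirichletEigenspace (L + 2) d m lam =
      ((level L d m).eigenspace (2 ^ d - (2 ^ d - 1) * lam)).comap
        (LinearEquiv.funCongrLeft ℝ ℝ (vertexEquiv L d m)).toLinearMap :=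
    Submodule.ext fun f => mem_dirichletEigenspace_iff m lam f
  rw [dirichletMultiplicity, hcomap]
  exact LinearEquiv.finrank_eq (LinearEquiv.ofSubmodule' _ _)

open Classical in
/-- The operator that is `-Δ_m` off the boundary and zero on the boundary. -/
def dirichletOperator (n d m : ℕ) : Module.End ℝ (vertices n d m → ℝ) where
  toFun f x := if (x : Fin d → ℝ) ∈ vertices n d 0 then 0 else -laplacian n d m f x
  map_add' f g := by
    funext x
    simp only [laplacian, Pi.add_apply, Finset.sum_add_distrib]
    split_ifs <;> ring
  map_smul' c f := by
    funext x
    simp only [laplacian, Pi.smul_apply, smul_eq_mul, RingHom.id_apply, ← Finset.mul_sum]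
    split_ifs <;> ring

theorem iSupIndep_dirichletEigenspace (n d m : ℕ) : iSupIndep (dirichletEigenspace n d m) := by
  refine (Module.End.eigenspaces_iSupIndep (dirichletOperator n d m)).mono fun lam f hf => ?_
  rw [Module.End.mem_eigenspace_iff]
  funext x
  change (if (x : Fin d → ℝ) ∈ vertices n d 0 then 0 else _) = lam * f x
  split_ifs with hx
  · rw [hf.1 x hx, mul_zero]
  · exact hf.2 x hx

theorem sum_finrank_le_of_iSupIndep {ι k V : Type*} [Field k] [AddCommGroup V] [Module k V]
    [FiniteDimensional k V] {E : ι → Submodule k V} (hE : iSupIndep E) {W : Submodule k V}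
    (hW : ∀ i, E i ≤ W) (F : Finset ι) : ∑ i ∈ F, finrank k (E i) ≤ finrank k W := by
  classical
  let Φ : (DirectSum F fun i => E i) →ₗ[k] W :=
    DirectSum.toModule k F W fun i => Submodule.inclusion (hW i)
  have hΦ : W.subtype ∘ₗ Φ = DFinsupp.lsum ℕ fun i : F => (E i).subtype := by
    refine DirectSum.linearMap_ext k fun i => LinearMap.ext fun x => ?_
    simp only [Φ, LinearMap.comp_apply, DirectSum.toModule_lof]
    exact (DFinsupp.lsum_single (M := fun i : F => E i) ℕ
      (fun i : F => (E i).subtype) i x).symm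
  have hcomp : Function.Injective (W.subtype ∘ₗ Φ) := by
    rw [hΦ]
    exact (hE.comp Subtype.val_injective : iSupIndep fun i : F => E i).dfinsupp_lsum_injective
  have hinj : Function.Injective Φ := Function.Injective.of_comp (f := W.subtype) hcomp
  rw [← Finset.sum_coe_sort F fun i => finrank k (E i), ← finrank_directSum]
  exact LinearMap.finrank_le_finrank_of_injective hinj

theorem sum_dirichletMultiplicity_le (F : Finset ℝ) :
    ∑ lam ∈ F, dirichletMultiplicity (L + 2) d m lam + 2 ^ d ≤
      Fintype.card (level L d m).Vertex := by
  let restr : (vertices (L + 2) d m → ℝ) →ₗ[ℝ] (Fin d → Bool) → ℝ :=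
    LinearMap.funLeft ℝ ℝ (vertexEquiv L d m ∘ (level L d m).bdry)
  have hker : ∀ lam, dirichletEigenspace (L + 2) d m lam ≤ LinearMap.ker restr :=
    fun lam f hf => funext fun a => hf.1 _ ((vertexEquiv_mem_boundary_iff m _).2 ⟨a, rfl⟩)
  have hsum := sum_finrank_le_of_iSupIndep (iSupIndep_dirichletEigenspace (L + 2) d m) hker F
  have hrank := restr.finrank_range_add_finrank_ker
  rw [LinearMap.range_eq_top.2 (LinearMap.funLeft_surjective_of_injective ℝ ℝ _
      ((vertexEquiv L d m).injective.comp (bdry_injective m))), finrank_top,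
    finrank_fintype_fun_eq_card, finrank_fintype_fun_eq_card,
    ← Fintype.card_congr (vertexEquiv L d m)] at hrank
  simp only [Fintype.card_pi, Fintype.card_bool, Finset.prod_const, Finset.card_univ,
    Fintype.card_fin] at hrank
  rw [← hrank, add_comm]
  exact Nat.add_le_add_left hsum _

end Laplacian

open CellSystem

section Trigonometry

variable (L : ℕ)

theorem evalU_add_mul_sin {θ : ℝ} (hθ : Real.cos θ ≠ 0) :
    (evalU (Real.cos (2 * θ)) (L + 1) + evalU (Real.cos (2 * θ)) L) * Real.sin θ =
      Real.sin ((2 * L + 3) * θ) := by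
  have h₁ := Chebyshev.U_real_cos (2 * θ) (L + 1)
  have h₀ := Chebyshev.U_real_cos (2 * θ) L
  push_cast at h₁ h₀
  rw [show ((L : ℝ) + 1 + 1) * (2 * θ) = (2 * L + 3) * θ + θ by ring, Real.sin_add,
    Real.sin_two_mul] at h₁
  rw [show ((L : ℝ) + 1) * (2 * θ) = (2 * L + 3) * θ - θ by ring, Real.sin_sub,
    Real.sin_two_mul] at h₀
  refine mul_right_cancel₀ (mul_ne_zero two_ne_zero hθ) ?_
  simp only [evalU]
  linear_combination h₁ + h₀

theorem evalU_sub_mul_cos {θ : ℝ} (hθ : Real.sin θ ≠ 0) :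
    (evalU (Real.cos (2 * θ)) (L + 1) - evalU (Real.cos (2 * θ)) L) * Real.cos θ =
      Real.cos ((2 * L + 3) * θ) := by
  have h₁ := Chebyshev.U_real_cos (2 * θ) (L + 1)
  have h₀ := Chebyshev.U_real_cos (2 * θ) L
  push_cast at h₁ h₀
  rw [show ((L : ℝ) + 1 + 1) * (2 * θ) = (2 * L + 3) * θ + θ by ring, Real.sin_add,
    Real.sin_two_mul] at h₁
  rw [show ((L : ℝ) + 1) * (2 * θ) = (2 * L + 3) * θ - θ by ring, Real.sin_sub,
    Real.sin_two_mul] at h₀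
  refine mul_right_cancel₀ (mul_ne_zero two_ne_zero hθ) ?_
  simp only [evalU]
  linear_combination h₁ - h₀

theorem evalU_natCast_pos {s : ℝ} (hs : 1 ≤ s) (j : ℕ) : 0 < evalU s j := by
  induction j with
  | zero => simp
  | succ j ih =>
    have hT : 1 ≤ (Chebyshev.T ℝ (j + 1)).eval s := Chebyshev.one_le_eval_T_real _ hs
    have hU := congrArg (eval s) (Chebyshev.U_eq_X_mul_U_add_T ℝ (j : ℤ))
    rw [eval_add, eval_mul, eval_X] at hU
    have : 0 < s * evalU s j := mul_pos (by linarith) ih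
    push_cast
    rw [evalU] at this ⊢
    linarith

end Trigonometry

section Decimation

theorem four_le_two_pow {d : ℕ} (hd : 2 ≤ d) : (4 : ℝ) ≤ 2 ^ d := by
  exact_mod_cast Nat.pow_le_pow_right (n := 2) two_pos hd

variable (L d : ℕ)

/-- The number `t = 1 - (2 ^ d - 1) λ`. -/
def tVal (x : ℝ) : ℝ := 1 - ((2 : ℝ) ^ d - 1) * x

theorem eval_chebU (j : ℤ) (x : ℝ) : (chebU d j).eval x = evalU (tVal d x) j := by
  simp [chebU, eval_comp, tPoly, tVal, evalU]

theorem A_eq : A (L + 2) d = chebU d (L + 1) + chebU d L := by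
  rw [A]
  congr 2 <;> push_cast <;> ring

theorem eval_A (x : ℝ) :
    (A (L + 2) d).eval x = evalU (tVal d x) (L + 1) + evalU (tVal d x) L := by
  rw [A_eq, eval_add, eval_chebU, eval_chebU]

theorem eval_S (x : ℝ) : (S (L + 2) d).eval x = evalS L (2 ^ d) (tVal d x) := by
  have hT (j : ℤ) : (chebT d j).eval x = (Chebyshev.T ℝ j).eval (tVal d x) := by
    simp [chebT, eval_comp, tPoly, tVal]
  rw [S, eval_add, eval_mul, eval_C, hT, hT, evalS]
  push_cast
  rw [show (L : ℤ) + 2 - 1 = L + 1 by ring, Chebyshev.T_eq_X_mul_U_sub_U,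
    Chebyshev.T_eq_U_sub_X_mul_U]
  simp [evalU]

/-- The factor of `2 ^ d - (2 ^ d - 1) R` complementary to `S`; its roots are the solutions of
`R = top` from which the eigenvalue `top` is inherited by the next level. -/
def cofactor : ℝ[X] := chebU d (L + 1) - chebU d L

theorem eval_cofactor (x : ℝ) :
    (cofactor L d).eval x = evalU (tVal d x) (L + 1) - evalU (tVal d x) L := by
  rw [cofactor, eval_sub, eval_chebU, eval_chebU]

theorem R_eq : R (L + 2) d = 1 + (X - 1) * chebU d (L + 1) ^ 2 +
    (tPoly d + X + 1) * chebU d (L + 1) * chebU d L - tPoly d * chebU d L ^ 2 := by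
  rw [R]
  push_cast
  rw [show (L : ℤ) + 2 - 1 = L + 1 by ring, show (L : ℤ) + 2 - 2 = L by ring]

theorem eval_R (x : ℝ) : (R (L + 2) d).eval x =
    x * (A (L + 2) d).eval x * (evalU (tVal d x) (L + 1) + (2 ^ d - 1) * evalU (tVal d x) L) := by
  have ht : (tPoly d).eval x = tVal d x := by simp [tPoly, tVal]
  have hx : ((2 : ℝ) ^ d - 1) * x = 1 - tVal d x := by rw [tVal]; ring
  have hU := evalU_sq_add_evalU_sq (tVal d x) (L : ℤ)
  rw [R_eq, eval_A]
  simp only [eval_add, eval_sub, eval_mul, eval_pow, eval_one, eval_X, ht, eval_chebU]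
  linear_combination -hU - (evalU (tVal d x) (L + 1) * evalU (tVal d x) L +
    evalU (tVal d x) L ^ 2) * hx

theorem two_pow_sub_eval_R (x : ℝ) : 2 ^ d - (2 ^ d - 1) * (R (L + 2) d).eval x =
    (S (L + 2) d).eval x * (cofactor L d).eval x := by
  have hx : ((2 : ℝ) ^ d - 1) * x = 1 - tVal d x := by rw [tVal]; ring
  have hU := evalU_sq_add_evalU_sq (tVal d x) (L : ℤ)
  rw [eval_R, eval_A, eval_S, eval_cofactor, evalS]
  linear_combination (-2 ^ d) * hU - (evalU (tVal d x) (L + 1) + evalU (tVal d x) L) *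
    (evalU (tVal d x) (L + 1) + (2 ^ d - 1) * evalU (tVal d x) L) * hx

theorem two_cos_mul_eval_R {x θ : ℝ} (hx : tVal d x = Real.cos (2 * θ)) (hs : Real.sin θ ≠ 0)
    (hc : Real.cos θ ≠ 0) :
    2 * Real.cos θ * ((2 ^ d - 1) * (R (L + 2) d).eval x) =
      2 ^ d * Real.cos θ * (1 - Real.cos (2 * ((2 * L + 3) * θ))) -
        (2 ^ d - 2) * Real.sin θ * Real.sin (2 * ((2 * L + 3) * θ)) := by
  have hx' : ((2 : ℝ) ^ d - 1) * x = 2 * Real.sin θ ^ 2 := by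
    rw [Real.cos_two_mul, Real.cos_sq', tVal] at hx
    linear_combination -hx
  rw [Real.cos_two_mul, Real.cos_sq', Real.sin_two_mul, ← evalU_add_mul_sin L hc,
    ← evalU_sub_mul_cos L hs, eval_R, eval_A, hx]
  generalize evalU (Real.cos (2 * θ)) (L + 1) = u
  generalize evalU (Real.cos (2 * θ)) L = v
  linear_combination 2 * Real.cos θ * (u + v) * (u + (2 ^ d - 1) * v) * hx'

theorem eval_R_zero : (R (L + 2) d).eval 0 = 0 := by
  rw [eval_R, zero_mul, zero_mul]

variable {L d} in
theorem eval_R_of_eval_A {y : ℝ} (h : (A (L + 2) d).eval y = 0) : (R (L + 2) d).eval y = 0 := by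
  rw [eval_R, h, mul_zero, zero_mul]

variable {d} (hd : 2 ≤ d)
include hd

theorem top_pos : 0 < top d := by
  have := four_le_two_pow hd
  exact div_pos (by linarith) (by linarith)

theorem top_mem_Icc : top d ∈ Set.Icc 0 (top d) := ⟨(top_pos hd).le, le_rfl⟩

theorem mul_top : (2 ^ d - 1) * top d = 2 ^ d :=
  mul_div_cancel₀ _ (by linarith [four_le_two_pow hd])

theorem eval_R_eq_top_iff {y : ℝ} : (R (L + 2) d).eval y = top d ↔
    (S (L + 2) d).eval y = 0 ∨ (cofactor L d).eval y = 0 := by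
  have hne : (2 : ℝ) ^ d - 1 ≠ 0 := by linarith [four_le_two_pow hd]
  have htop := mul_top hd
  rw [← mul_eq_zero, ← two_pow_sub_eval_R, sub_eq_zero, ← mul_right_inj' hne, htop, eq_comm]

variable {L} in
theorem eval_R_of_eval_S {y : ℝ} (h : (S (L + 2) d).eval y = 0) :
    (R (L + 2) d).eval y = top d := (eval_R_eq_top_iff L hd).mpr (Or.inl h)

variable {L} in
theorem eval_R_of_eval_cofactor {y : ℝ} (h : (cofactor L d).eval y = 0) :
    (R (L + 2) d).eval y = top d := (eval_R_eq_top_iff L hd).mpr (Or.inr h)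

variable {L} in
theorem eval_S_ne_zero_of_eval_cofactor {y : ℝ} (h : (cofactor L d).eval y = 0) :
    (S (L + 2) d).eval y ≠ 0 := by
  intro hS
  have hU := evalU_sq_add_evalU_sq (tVal d y) (L : ℤ)
  rw [eval_cofactor, sub_eq_zero] at h
  rw [eval_S, evalS, h] at hS
  rw [h] at hU
  have hzero : (2 ^ d - 2) * ((1 - tVal d y) * evalU (tVal d y) L) = 0 := by
    linear_combination hS
  have hzero' := (mul_eq_zero.mp hzero).resolve_left (by linarith [four_le_two_pow hd])
  exact one_ne_zero (α := ℝ) (by linear_combination 2 * evalU (tVal d y) L * hzero' - hU)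

theorem top_lt_eval_R_top : top d < (R (L + 2) d).eval (top d) := by
  have hP := four_le_two_pow hd
  have ht : tVal d (top d) = -(2 ^ d - 1) := by rw [tVal, mul_top hd]; ring
  set s : ℝ := 2 ^ d - 1
  have hT : 1 < (Chebyshev.T ℝ (L + 1)).eval s :=
    Chebyshev.one_lt_eval_T_real (by omega) (by linarith)
  have hU : 0 < evalU s L := evalU_natCast_pos (by linarith) L
  have hUT : evalU s (L + 1) = s * evalU s L + (Chebyshev.T ℝ (L + 1)).eval s := by
    simp [evalU, Chebyshev.U_eq_X_mul_U_add_T]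
  have hneg (j : ℕ) : evalU (-s) j = (-1) ^ j * evalU s j := by simp [evalU, Chebyshev.U_eval_neg]
  have hneg' := hneg (L + 1)
  push_cast at hneg'
  have hsq : ((-1 : ℝ) ^ L) ^ 2 = 1 := by rw [← pow_mul, mul_comm, pow_mul]; norm_num
  have hprod : (evalU (-s) (L + 1) + evalU (-s) L) * (evalU (-s) (L + 1) + s * evalU (-s) L) =
      (Chebyshev.T ℝ (L + 1)).eval s * ((Chebyshev.T ℝ (L + 1)).eval s + (s - 1) * evalU s L) := by
    rw [hneg', hneg, hUT]
    linear_combination ((Chebyshev.T ℝ (L + 1)).eval s *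
      ((Chebyshev.T ℝ (L + 1)).eval s + (s - 1) * evalU s L)) * hsq
  rw [eval_R, eval_A, ht, mul_assoc, hprod]
  refine lt_mul_of_one_lt_right (top_pos hd) (one_lt_mul_of_lt_of_le hT ?_)
  have : 0 < (s - 1) * evalU s L := mul_pos (by linarith) hU
  linarith

end Decimation

section Nodes

open CellSystem Set

variable (L d : ℕ)

/-- The number `λ` for which `t = cos (π r)`. -/
def arcPoint (r : ℝ) : ℝ := (1 - Real.cos (Real.pi * r)) / (2 ^ d - 1)

/-- The points `0 = ν_0 < ν_1 < ⋯ < ν_{2 L + 3} = top` separating the inverse branches of `R`; at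
the interior ones `t = cos (2 k π / (4 L + 5))`, an angle chosen so that `R` is alternately negative
and larger than `top`. The sequence is constant from index `2 L + 3` on. -/
def node (k : ℕ) : ℝ := if k ≤ 2 * L + 2 then arcPoint d (2 * k / (4 * L + 5)) else top d

theorem node_of_le {k : ℕ} (hk : k ≤ 2 * L + 2) :
    node L d k = arcPoint d (2 * k / (4 * L + 5)) := if_pos hk

theorem node_zero : node L d 0 = 0 := by simp [node, arcPoint]

theorem node_last : node L d (2 * L + 3) = top d := by simp [node]

theorem sin_half_pos {r : ℝ} (hr : r ∈ Ioo 0 1) : 0 < Real.sin (Real.pi * r / 2) := by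
  have := Real.pi_pos
  exact Real.sin_pos_of_pos_of_lt_pi (by nlinarith [hr.1]) (by nlinarith [hr.2])

theorem cos_half_pos {r : ℝ} (hr : r ∈ Ioo 0 1) : 0 < Real.cos (Real.pi * r / 2) := by
  have := Real.pi_pos
  exact Real.cos_pos_of_mem_Ioo ⟨by nlinarith [hr.1], by nlinarith [hr.2]⟩

variable {d} (hd : 2 ≤ d)
include hd

theorem tVal_arcPoint (r : ℝ) : tVal d (arcPoint d r) = Real.cos (2 * (Real.pi * r / 2)) := by
  have : (2 : ℝ) ^ d - 1 ≠ 0 := by linarith [four_le_two_pow hd]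
  rw [tVal, arcPoint, mul_div_cancel₀ _ this, mul_div_cancel₀ _ two_ne_zero, sub_sub_cancel]

theorem strictMonoOn_arcPoint : StrictMonoOn (arcPoint d) (Icc 0 1) := by
  intro r hr s hs hrs
  have := Real.pi_pos
  have hcos : Real.cos (Real.pi * s) < Real.cos (Real.pi * r) :=
    Real.cos_lt_cos_of_nonneg_of_le_pi (by nlinarith [hr.1]) (by nlinarith [hs.2]) (by gcongr)
  exact div_lt_div_of_pos_right (by linarith) (by linarith [four_le_two_pow hd])

theorem arcPoint_lt_top (r : ℝ) : arcPoint d r < top d := by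
  have := four_le_two_pow hd
  have := Real.neg_one_le_cos (Real.pi * r)
  exact div_lt_div_of_pos_right (by linarith) (by linarith)

theorem monotone_node : Monotone (node L d) := by
  refine monotone_nat_of_le_succ fun k => ?_
  rw [node, node]
  split_ifs with hk hk' hk'
  · have : ((k + 1 : ℕ) : ℝ) ≤ 2 * L + 2 := by exact_mod_cast hk'
    have hlt : 2 * (k : ℝ) / (4 * L + 5) < 2 * ((k + 1 : ℕ) : ℝ) / (4 * L + 5) := by
      gcongr
      exact k.lt_succ_self
    have hle : 2 * ((k + 1 : ℕ) : ℝ) / (4 * L + 5) ≤ 1 := by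
      rw [div_le_one (by positivity)]
      linarith
    exact (strictMonoOn_arcPoint hd ⟨by positivity, hlt.le.trans hle⟩ ⟨by positivity, hle⟩ hlt).le
  · exact (arcPoint_lt_top hd _).le
  · omega
  · exact le_rfl

variable {L} in
theorem exists_two_mul_eval_R_node {k : ℕ} (hk₀ : 0 < k) (hk : k ≤ 2 * L + 2) :
    ∃ c ∈ Ioo (0 : ℝ) 1, 2 * c * ((2 ^ d - 1) * (R (L + 2) d).eval (node L d k)) =
      2 ^ d * c * (1 - (-1) ^ k * c) - (-1) ^ k * (2 ^ d - 2) * (1 - c ^ 2) := by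
  have hk' : (k : ℝ) ≤ 2 * L + 2 := by exact_mod_cast hk
  have hr : 2 * (k : ℝ) / (4 * L + 5) ∈ Ioo 0 1 := by
    refine ⟨by positivity, ?_⟩
    rw [div_lt_one (by positivity)]
    linarith
  have hsin := sin_half_pos hr
  have hcos := cos_half_pos hr
  have ht := tVal_arcPoint hd (2 * (k : ℝ) / (4 * L + 5))
  rw [← node_of_le L d hk] at ht
  have hR := two_cos_mul_eval_R L d ht hsin.ne' hcos.ne'
  set θ := Real.pi * (2 * (k : ℝ) / (4 * L + 5)) / 2 with hθ
  have hangle : 2 * ((2 * L + 3) * θ) = θ + k * Real.pi := by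
    rw [hθ]
    field_simp
    ring
  rw [hangle, Real.cos_add_nat_mul_pi, Real.sin_add_nat_mul_pi] at hR
  have hsq := Real.sin_sq_add_cos_sq θ
  refine ⟨Real.cos θ, ⟨hcos, by nlinarith⟩, ?_⟩
  linear_combination hR - (-1) ^ k * (2 ^ d - 2) * hsq

variable {L} in
theorem eval_R_node_neg {k : ℕ} (hk₀ : 0 < k) (hk : k ≤ 2 * L + 2) (heven : Even k) :
    (R (L + 2) d).eval (node L d k) < 0 := by
  obtain ⟨c, ⟨hc₀, hc₁⟩, hR⟩ := exists_two_mul_eval_R_node hd hk₀ hk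
  have hP := four_le_two_pow hd
  have hneg : 2 * c * ((2 ^ d - 1) * (R (L + 2) d).eval (node L d k)) < 0 := by
    rw [hR, heven.neg_one_pow]
    have : 0 < (1 - c) * (2 ^ d - 2 - 2 * c) := mul_pos (by linarith) (by linarith)
    linarith
  exact neg_of_mul_neg_right (neg_of_mul_neg_right hneg (by linarith)) (by linarith)

variable {L} in
theorem top_lt_eval_R_node {k : ℕ} (hk : k ≤ 2 * L + 3) (hodd : Odd k) :
    top d < (R (L + 2) d).eval (node L d k) := by
  rcases hk.eq_or_lt with rfl | hk
  · rw [node_last]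
    exact top_lt_eval_R_top L hd
  obtain ⟨c, ⟨hc₀, hc₁⟩, hR⟩ := exists_two_mul_eval_R_node hd hodd.pos (Nat.le_of_lt_succ hk)
  have hP := four_le_two_pow hd
  have hpos : 0 < 2 * c * ((2 ^ d - 1) * ((R (L + 2) d).eval (node L d k) - top d)) := by
    rw [mul_sub, mul_sub, hR, mul_top hd, hodd.neg_one_pow]
    have : 0 < (1 - c) * (2 ^ d - 2 - 2 * c) := mul_pos (by linarith) (by linarith)
    linarith
  exact sub_pos.mp (pos_of_mul_pos_right (pos_of_mul_pos_right hpos (by linarith)) (by linarith))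

variable {L} in
theorem exists_eval_R_eq {x : ℝ} (hx : x ∈ Icc 0 (top d)) {k : ℕ} (hk : k < 2 * L + 3) :
    ∃ y ∈ Ico (node L d k) (node L d (k + 1)), (R (L + 2) d).eval y = x := by
  have hle : node L d k ≤ node L d (k + 1) := monotone_node L hd k.le_succ
  have hcont := (Polynomial.continuous (R (L + 2) d)).continuousOn
    (s := Icc (node L d k) (node L d (k + 1)))
  rcases k.even_or_odd with heven | hodd
  · have hleft : (R (L + 2) d).eval (node L d k) ≤ 0 := by
      rcases k.eq_zero_or_pos with rfl | hk₀
      · rw [node_zero, eval_R_zero]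
      · exact (eval_R_node_neg hd hk₀ (by omega) heven).le
    exact intermediate_value_Ico hle hcont
      ⟨hleft.trans hx.1, hx.2.trans_lt (top_lt_eval_R_node hd (by omega) heven.add_one)⟩
  · have hk' : k + 1 ≤ 2 * L + 2 := by grind
    exact intermediate_value_Ico' hle hcont
      ⟨(eval_R_node_neg hd k.succ_pos hk' hodd.add_one).trans_le hx.1,
        hx.2.trans (top_lt_eval_R_node hd hk.le hodd).le⟩

end Nodes

section Roots

theorem mem_roots_toFinset {p : ℝ[X]} (hp : p ≠ 0) {y : ℝ} :
    y ∈ p.roots.toFinset ↔ p.eval y = 0 := by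
  rw [Multiset.mem_toFinset, mem_roots hp, IsRoot.def]

theorem ncard_setOf_eval_eq_zero {p : ℝ[X]} (hp : p ≠ 0) :
    {y : ℝ | p.eval y = 0}.ncard = p.roots.toFinset.card := by
  rw [← Set.ncard_coe_finset]
  congr 1
  ext y
  rw [Set.mem_ofPred_eq, Finset.mem_coe, mem_roots_toFinset hp]

theorem roots_toFinset_eq_image {p : ℝ[X]} (hp : p ≠ 0) {N : ℕ} (hN : p.natDegree ≤ N)
    {r : Fin N → ℝ} (hr : Function.Injective r) (hroot : ∀ i, p.eval (r i) = 0) :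
    p.roots.toFinset = Finset.univ.image r := by
  refine (Finset.eq_of_subset_of_card_le ?_ ?_).symm
  · intro y hy
    obtain ⟨i, -, rfl⟩ := Finset.mem_image.mp hy
    exact (mem_roots_toFinset hp).mpr (hroot i)
  · rw [Finset.card_image_of_injective _ hr, Finset.card_univ, Fintype.card_fin]
    exact (Multiset.toFinset_card_le _).trans ((card_roots' p).trans hN)

theorem sort_image_getD {N : ℕ} {r : Fin N → ℝ} (hr : StrictMono r) (i : Fin N) :
    ((Finset.univ.image r).sort (· ≤ ·)).getD i 0 = r i := by
  have hcard : (Finset.univ.image r).card = N := by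
    rw [Finset.card_image_of_injective _ hr.injective, Finset.card_univ, Fintype.card_fin]
  have hemb := Finset.orderEmbOfFin_unique hcard
    (fun i => Finset.mem_image_of_mem r (Finset.mem_univ i)) hr
  rw [congrFun hemb i, Finset.orderEmbOfFin_apply, List.getD_eq_getElem]
  rfl

theorem strictMono_of_mem_Ico {N : ℕ} {ν : ℕ → ℝ} (hν : Monotone ν) {r : Fin N → ℝ}
    (hr : ∀ k : Fin N, r k ∈ Set.Ico (ν k) (ν (k + 1))) : StrictMono r := fun j k hjk =>
  (hr j).2.trans_le ((hν (Nat.succ_le_of_lt hjk)).trans (hr k).1)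

variable (L d : ℕ)

theorem natDegree_tPoly_le : (tPoly d).natDegree ≤ 1 := by
  rw [tPoly]
  compute_degree

theorem natDegree_chebU_le (j : ℕ) : (chebU d j).natDegree ≤ j := by
  refine natDegree_comp_le.trans ?_
  rw [Chebyshev.natDegree_U_natCast]
  exact (Nat.mul_le_mul_left j (natDegree_tPoly_le d)).trans_eq j.mul_one

theorem natDegree_chebU_succ_le : (chebU d (L + 1)).natDegree ≤ L + 1 := by
  exact_mod_cast natDegree_chebU_le d (L + 1)

theorem natDegree_A_le : (A (L + 2) d).natDegree ≤ L + 1 := by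
  rw [A_eq]
  exact natDegree_add_le_of_degree_le (natDegree_chebU_succ_le L d)
    ((natDegree_chebU_le d L).trans L.le_succ)

theorem natDegree_cofactor_le : (cofactor L d).natDegree ≤ L + 1 :=
  (natDegree_sub_le_of_le (natDegree_chebU_succ_le L d)
    ((natDegree_chebU_le d L).trans L.le_succ)).trans_eq (max_self _)

theorem natDegree_R_sub_C_le (x : ℝ) : (R (L + 2) d - C x).natDegree ≤ 2 * L + 3 := by
  have hU := natDegree_chebU_succ_le L d
  have hU' := natDegree_chebU_le d L
  have ht := natDegree_tPoly_le d
  have hX : (X - 1 : ℝ[X]).natDegree ≤ 1 := by compute_degree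
  have htX : (tPoly d + X + 1).natDegree ≤ 1 :=
    natDegree_add_le_of_degree_le (natDegree_add_le_of_degree_le ht natDegree_X_le) (by simp)
  rw [natDegree_sub_C, R_eq, sub_eq_add_neg]
  refine natDegree_add_le_of_degree_le (natDegree_add_le_of_degree_le
    (natDegree_add_le_of_degree_le (by simp) ?_) ?_) ?_
  · exact (natDegree_mul_le_of_le hX (natDegree_pow_le_of_le 2 hU)).trans (by omega)
  · exact (natDegree_mul_le_of_le (natDegree_mul_le_of_le htX hU) hU').trans (by omega)
  · rw [natDegree_neg]
    exact (natDegree_mul_le_of_le ht (natDegree_pow_le_of_le 2 hU')).trans (by omega)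

variable {d} (hd : 2 ≤ d)
include hd

theorem A_ne_zero : A (L + 2) d ≠ 0 := by
  intro h
  have := eval_R_of_eval_A (L := L) (d := d) (y := top d) (by rw [h, eval_zero])
  linarith [top_lt_eval_R_top L hd, top_pos hd]

theorem S_ne_zero : S (L + 2) d ≠ 0 := by
  intro h
  have := eval_R_of_eval_S (L := L) (y := top d) hd (by rw [h, eval_zero])
  linarith [top_lt_eval_R_top L hd]

theorem cofactor_ne_zero : cofactor L d ≠ 0 := by
  intro h
  have := eval_R_of_eval_cofactor (y := top d) hd (by rw [h, eval_zero])
  linarith [top_lt_eval_R_top L hd]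

theorem R_sub_C_ne_zero (x : ℝ) : R (L + 2) d - C x ≠ 0 := by
  intro h
  have hconst (y : ℝ) : (R (L + 2) d).eval y = x := by rw [sub_eq_zero.mp h, eval_C]
  have htop := top_lt_eval_R_top L hd
  rw [hconst, ← hconst 0, eval_R_zero] at htop
  exact htop.not_gt (top_pos hd)

omit hd in
variable {L} in
theorem two_mul_add_div_mem_Ioo {c : ℝ} (hc : c ∈ Set.Ioc 0 2) (j : Fin (L + 1)) :
    (2 * j + c) / (2 * L + 3) ∈ Set.Ioo (0 : ℝ) 1 := by
  have hj : (j : ℝ) ≤ L := by exact_mod_cast j.is_le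
  have hc₀ := hc.1
  refine ⟨by positivity, ?_⟩
  rw [div_lt_one (by positivity)]
  linarith [hc.2]

theorem strictMono_arcPoint_two_mul_add {c : ℝ} (hc : c ∈ Set.Ioc 0 2) :
    StrictMono fun j : Fin (L + 1) => arcPoint d ((2 * j + c) / (2 * L + 3)) := by
  intro j k hjk
  refine strictMonoOn_arcPoint hd (Set.Ioo_subset_Icc_self (two_mul_add_div_mem_Ioo hc j))
    (Set.Ioo_subset_Icc_self (two_mul_add_div_mem_Ioo hc k)) ?_
  gcongr
  exact hjk

theorem roots_A_toFinset : (A (L + 2) d).roots.toFinset =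
    Finset.univ.image fun j : Fin (L + 1) => arcPoint d ((2 * j + 2) / (2 * L + 3)) := by
  have hc : (2 : ℝ) ∈ Set.Ioc 0 2 := ⟨two_pos, le_rfl⟩
  refine roots_toFinset_eq_image (A_ne_zero L hd) (natDegree_A_le L d)
    (strictMono_arcPoint_two_mul_add L hd hc).injective fun j => ?_
  have hr := two_mul_add_div_mem_Ioo hc j
  have hangle : (2 * L + 3) * (Real.pi * ((2 * j + 2) / (2 * L + 3)) / 2) =
      ((j + 1 : ℕ) : ℝ) * Real.pi := by
    push_cast
    field_simp
  have hsin := evalU_add_mul_sin L (cos_half_pos hr).ne'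
  rw [hangle, Real.sin_nat_mul_pi, ← tVal_arcPoint hd, ← eval_A] at hsin
  exact (mul_eq_zero.mp hsin).resolve_right (sin_half_pos hr).ne'

theorem roots_cofactor_toFinset : (cofactor L d).roots.toFinset =
    Finset.univ.image fun j : Fin (L + 1) => arcPoint d ((2 * j + 1) / (2 * L + 3)) := by
  have hc : (1 : ℝ) ∈ Set.Ioc 0 2 := ⟨one_pos, one_le_two⟩
  refine roots_toFinset_eq_image (cofactor_ne_zero L hd) (natDegree_cofactor_le L d)
    (strictMono_arcPoint_two_mul_add L hd hc).injective fun j => ?_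
  have hr := two_mul_add_div_mem_Ioo hc j
  have hangle : (2 * L + 3) * (Real.pi * ((2 * j + 1) / (2 * L + 3)) / 2) =
      Real.pi / 2 + (j : ℕ) * Real.pi := by
    field_simp
    ring
  have hcos := evalU_sub_mul_cos L (sin_half_pos hr).ne'
  rw [hangle, Real.cos_add_nat_mul_pi, Real.cos_pi_div_two, mul_zero, ← tVal_arcPoint hd,
    ← eval_cofactor] at hcos
  exact (mul_eq_zero.mp hcos).resolve_right (cos_half_pos hr).ne'

theorem card_roots_A_toFinset : (A (L + 2) d).roots.toFinset.card = L + 1 := by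
  rw [roots_A_toFinset L hd, Finset.card_image_of_injective _
    (strictMono_arcPoint_two_mul_add L hd ⟨two_pos, le_rfl⟩).injective, Finset.card_fin]

theorem card_roots_cofactor_toFinset : (cofactor L d).roots.toFinset.card = L + 1 := by
  rw [roots_cofactor_toFinset L hd, Finset.card_image_of_injective _
    (strictMono_arcPoint_two_mul_add L hd ⟨one_pos, one_le_two⟩).injective, Finset.card_fin]

end Roots

section Branches

variable (L d : ℕ)

/-- The set of solutions of `R = x`. -/
def fiber (x : ℝ) : Finset ℝ := (R (L + 2) d - C x).roots.toFinset

variable {d} (hd : 2 ≤ d)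
include hd

theorem mem_fiber {x y : ℝ} : y ∈ fiber L d x ↔ (R (L + 2) d).eval y = x := by
  rw [fiber, mem_roots_toFinset (R_sub_C_ne_zero L hd x), eval_sub, eval_C, sub_eq_zero]

variable {L} {x : ℝ} (hx : x ∈ Set.Icc 0 (top d))
include hx

theorem branch_mem_Ico_and_fiber_eq_image :
    (∀ l : Fin (2 * L + 3), branch (L + 2) d l x ∈ Set.Ico (node L d l) (node L d (l + 1))) ∧
      fiber L d x = Finset.univ.image fun l : Fin (2 * L + 3) => branch (L + 2) d l x := by
  choose r hr hrx using fun l : Fin (2 * L + 3) => exists_eval_R_eq hd hx l.2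
  have hmono : StrictMono r := strictMono_of_mem_Ico (monotone_node L hd) hr
  have hfiber : fiber L d x = Finset.univ.image r :=
    roots_toFinset_eq_image (R_sub_C_ne_zero L hd x) (natDegree_R_sub_C_le L d x) hmono.injective
      fun l => by rw [eval_sub, eval_C, hrx, sub_self]
  have hbranch (l : Fin (2 * L + 3)) : branch (L + 2) d l x = r l := by
    rw [branch, ← fiber, hfiber]
    exact sort_image_getD hmono l
  simp only [hbranch]
  exact ⟨hr, hfiber⟩

theorem branch_mem_Ico (l : Fin (2 * L + 3)) :
    branch (L + 2) d l x ∈ Set.Ico (node L d l) (node L d (l + 1)) :=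
  (branch_mem_Ico_and_fiber_eq_image hd hx).1 l

theorem fiber_eq_image :
    fiber L d x = Finset.univ.image fun l : Fin (2 * L + 3) => branch (L + 2) d l x :=
  (branch_mem_Ico_and_fiber_eq_image hd hx).2

theorem strictMono_branch : StrictMono fun l : Fin (2 * L + 3) => branch (L + 2) d l x :=
  strictMono_of_mem_Ico (monotone_node L hd) (branch_mem_Ico hd hx)

theorem card_fiber : (fiber L d x).card = 2 * L + 3 := by
  rw [fiber_eq_image hd hx, Finset.card_image_of_injective _ (strictMono_branch hd hx).injective,
    Finset.card_fin]

theorem ncard_setOf_eval_R_eq : {y : ℝ | (R (L + 2) d).eval y = x}.ncard = 2 * L + 3 := by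
  rw [← card_fiber hd hx, ← Set.ncard_coe_finset]
  exact congrArg Set.ncard (Set.ext fun y => (mem_fiber L hd).symm)

theorem eval_R_branch (l : Fin (2 * L + 3)) : (R (L + 2) d).eval (branch (L + 2) d l x) = x := by
  rw [← mem_fiber L hd, fiber_eq_image hd hx]
  exact Finset.mem_image_of_mem _ (Finset.mem_univ l)

theorem exists_branch_eq {y : ℝ} (hy : (R (L + 2) d).eval y = x) :
    ∃ l : Fin (2 * L + 3), branch (L + 2) d l x = y := by
  rw [← mem_fiber L hd, fiber_eq_image hd hx] at hy
  simpa using hy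

theorem branch_eq_of_mem_Ico {y : ℝ} (hy : (R (L + 2) d).eval y = x) {l : ℕ}
    (hl : y ∈ Set.Ico (node L d l) (node L d (l + 1))) : branch (L + 2) d l x = y := by
  obtain ⟨k, rfl⟩ := exists_branch_eq hd hx hy
  have hkl : (k : ℕ) = l := by
    by_contra hne
    exact Set.disjoint_left.mp ((monotone_node L hd).pairwise_disjoint_on_Ico_succ hne)
      (branch_mem_Ico hd hx k) hl
  rw [← hkl]

theorem mem_Ico_of_eval_R {y : ℝ} (hy : (R (L + 2) d).eval y = x) : y ∈ Set.Ico 0 (top d) := by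
  obtain ⟨l, rfl⟩ := exists_branch_eq hd hx hy
  have hnode := monotone_node L hd
  rw [← node_zero L d, ← node_last L d]
  exact Set.Ico_subset_Ico (hnode l.val.zero_le) (hnode l.is_lt) (branch_mem_Ico hd hx l)

omit hx in
theorem branch_two_mul_top (j : Fin (L + 1)) :
    branch (L + 2) d (2 * j) (top d) = arcPoint d ((2 * j + 1) / (2 * L + 3)) := by
  have hr := two_mul_add_div_mem_Ioo (c := 1) ⟨one_pos, one_le_two⟩ j
  have hj : (j : ℝ) ≤ L := by exact_mod_cast j.is_le
  have hj' : (j : ℕ) < L + 1 := j.is_lt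
  have hroot : (cofactor L d).eval (arcPoint d ((2 * j + 1) / (2 * L + 3))) = 0 := by
    rw [← mem_roots_toFinset (cofactor_ne_zero L hd), roots_cofactor_toFinset L hd]
    exact Finset.mem_image_of_mem _ (Finset.mem_univ j)
  refine branch_eq_of_mem_Ico hd (top_mem_Icc hd) (eval_R_of_eval_cofactor hd hroot) ?_
  rw [node_of_le L d (by omega), node_of_le L d (by omega)]
  push_cast
  have hleft : 2 * (2 * j) / (4 * L + 5) ≤ (2 * j + 1) / (2 * L + 3 : ℝ) := by
    rw [div_le_div_iff₀ (by positivity) (by positivity)]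
    linarith
  have hright : (2 * j + 1) / (2 * L + 3 : ℝ) < 2 * (2 * j + 1) / (4 * L + 5) := by
    rw [div_lt_div_iff₀ (by positivity) (by positivity)]
    linarith
  have hlast : 2 * (2 * j + 1) / (4 * L + 5 : ℝ) ≤ 1 := by
    rw [div_le_one (by positivity)]
    linarith
  have hmono := strictMonoOn_arcPoint hd
  have hr' := Set.Ioo_subset_Icc_self hr
  exact ⟨hmono.monotoneOn ⟨by positivity, hleft.trans hr'.2⟩ hr' hleft,
    hmono hr' ⟨by positivity, hlast⟩ hright⟩

omit hx in
theorem eval_cofactor_branch_top_eq_zero_iff (l : Fin (2 * L + 3)) :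
    (cofactor L d).eval (branch (L + 2) d l (top d)) = 0 ↔
      Even (l : ℕ) ∧ (l : ℕ) + 4 ≤ 2 * (L + 2) := by
  rw [← mem_roots_toFinset (cofactor_ne_zero L hd), roots_cofactor_toFinset L hd]
  simp only [Finset.mem_image, Finset.mem_univ, true_and, ← branch_two_mul_top hd]
  constructor
  · rintro ⟨j, hj⟩
    have hl : 2 * (j : ℕ) = l := congrArg Fin.val <|
      (strictMono_branch hd (top_mem_Icc hd)).injective (a₁ := ⟨2 * j, by omega⟩) hj
    exact ⟨⟨j, by omega⟩, by omega⟩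
  · rintro ⟨⟨k, hk⟩, hl⟩
    exact ⟨⟨k, by omega⟩, by rw [hk, two_mul]⟩

omit hx in
variable (L) in
theorem fiber_top : fiber L d (top d) =
    (S (L + 2) d).roots.toFinset ∪ (cofactor L d).roots.toFinset := by
  ext y
  rw [mem_fiber L hd, eval_R_eq_top_iff L hd, Finset.mem_union,
    mem_roots_toFinset (S_ne_zero L hd), mem_roots_toFinset (cofactor_ne_zero L hd)]

omit hx in
variable (L) in
theorem disjoint_roots_S_cofactor :
    Disjoint (S (L + 2) d).roots.toFinset (cofactor L d).roots.toFinset := by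
  refine Finset.disjoint_left.mpr fun y hS hcof => ?_
  rw [mem_roots_toFinset (S_ne_zero L hd)] at hS
  rw [mem_roots_toFinset (cofactor_ne_zero L hd)] at hcof
  exact eval_S_ne_zero_of_eval_cofactor hd hcof hS

omit hx in
variable (L) in
theorem card_roots_S_toFinset : (S (L + 2) d).roots.toFinset.card = L + 2 := by
  have hcard := card_fiber (L := L) hd (top_mem_Icc hd)
  rw [fiber_top L hd, Finset.card_union_of_disjoint (disjoint_roots_S_cofactor L hd),
    card_roots_cofactor_toFinset L hd] at hcard
  omega

end Branches

section Cardinality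

variable (L d : ℕ) [NeZero d] (m : ℕ)

theorem card_level_cell : Fintype.card (level L d m).Cell = (2 ^ d * (L + 1) + 1) ^ m := by
  induction m with
  | zero => rfl
  | succ m ih =>
    refine (card_refine_cell ..).trans ?_
    rw [ih, pow_succ]
    simp

theorem card_level_vertex :
    Fintype.card (level L d m).Vertex = (2 ^ d - 1) * (2 ^ d * (L + 1) + 1) ^ m + 1 := by
  induction m with
  | zero =>
    have hpow : 1 ≤ 2 ^ d := Nat.one_le_two_pow
    have hcard : Fintype.card (level L d 0).Vertex = 2 ^ d := by
      change Fintype.card (Fin d → Bool) = _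
      simp
    rw [hcard, pow_zero, mul_one, Nat.sub_add_cancel hpow]
  | succ m ih =>
    refine (card_refine_vertex ..).trans ?_
    rw [ih, card_level_cell]
    simp only [Fintype.card_fun, Fintype.card_bool, Fintype.card_fin]
    ring

end Cardinality

section Location

open Set

variable {L d : ℕ} (hd : 2 ≤ d)
include hd

theorem mem_Ioo_of_eval_R {x y : ℝ} (hx : x ∈ Ioc 0 (top d)) (hy : (R (L + 2) d).eval y = x) :
    y ∈ Ioo 0 (top d) := by
  have hmem := mem_Ico_of_eval_R hd (Ioc_subset_Icc_self hx) hy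
  refine ⟨hmem.1.lt_of_ne ?_, hmem.2⟩
  rintro rfl
  rw [eval_R_zero] at hy
  exact hx.1.ne hy

theorem mem_Ioo_of_eval_A {y : ℝ} (hy : (A (L + 2) d).eval y = 0) : y ∈ Ioo 0 (top d) := by
  have hmem := mem_Ico_of_eval_R hd ⟨le_rfl, (top_pos hd).le⟩ (eval_R_of_eval_A hy)
  refine ⟨hmem.1.lt_of_ne ?_, hmem.2⟩
  rintro rfl
  have hU (j : ℕ) : 0 < evalU (tVal d 0) j := evalU_natCast_pos (by simp [tVal]) j
  rw [eval_A] at hy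
  exact (add_pos (hU (L + 1)) (hU L)).ne' (by exact_mod_cast hy)

theorem mem_Ioo_of_eval_S {y : ℝ} (hy : (S (L + 2) d).eval y = 0) : y ∈ Ioo 0 (top d) :=
  mem_Ioo_of_eval_R hd ⟨top_pos hd, le_rfl⟩ (eval_R_of_eval_S hd hy)

theorem branch_mem_Ioo {x : ℝ} (hx : x ∈ Ioc 0 (top d)) (l : Fin (2 * L + 3)) :
    branch (L + 2) d l x ∈ Ioo 0 (top d) :=
  mem_Ioo_of_eval_R hd hx (eval_R_branch hd (Ioc_subset_Icc_self hx) l)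

end Location

section ExpectedMultiplicity

variable (L d : ℕ)

/-- The multiplicity of `top d` at level `m`. For `m = 0` the truncated subtraction gives the
correct value `0`. -/
def topMult (m : ℕ) : ℕ := (2 ^ d * (L + 1) + 1) ^ m * (2 ^ d - 2) + 1 - 2 ^ d

open Classical in
/-- The multiplicity of `x` at level `m` according to spectral decimation: the eigenvalues born at
level `m` are `top d`, the roots of `A` and, for `m = 1`, the roots of `S`; the other ones inherit
the multiplicity of `R x` at level `m - 1`. -/
def expectedMult : ℕ → ℝ → ℕ
  | 0, _ => 0
  | m + 1, x =>
    if x = top d then topMult L d (m + 1)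
    else if (A (L + 2) d).eval x = 0 then 2 ^ d - 1
    else if (S (L + 2) d).eval x = 0 then (if m = 0 then 1 else 0)
    else expectedMult m ((R (L + 2) d).eval x)

theorem expectedMult_succ_of_ne (m : ℕ) {x : ℝ} (htop : x ≠ top d)
    (hA : (A (L + 2) d).eval x ≠ 0) (hS : (S (L + 2) d).eval x ≠ 0) :
    expectedMult L d (m + 1) x = expectedMult L d m ((R (L + 2) d).eval x) := by
  rw [expectedMult, if_neg htop, if_neg hA, if_neg hS]

variable {d} (hd : 2 ≤ d)
include hd

theorem four_le_two_pow_nat : 4 ≤ 2 ^ d := by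
  exact_mod_cast four_le_two_pow hd

theorem cast_topMult (m : ℕ) : (topMult L d m : ℤ) =
    (2 ^ d * (L + 1) + 1) ^ m * (2 ^ d - 2) + 1 - 2 ^ d + if m = 0 then 1 else 0 := by
  have hP := four_le_two_pow_nat hd
  rcases eq_or_ne m 0 with rfl | hm
  · simp [topMult]
    omega
  · have hpow : 2 ^ d * (L + 1) + 1 ≤ (2 ^ d * (L + 1) + 1) ^ m := Nat.le_self_pow hm _
    have hle : 2 ^ d ≤ (2 ^ d * (L + 1) + 1) ^ m * (2 ^ d - 2) + 1 := by
      have hmul := Nat.mul_le_mul hpow (by omega : 1 ≤ 2 ^ d - 2)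
      have hL : 2 ^ d ≤ 2 ^ d * (L + 1) := Nat.le_mul_of_pos_right _ L.succ_pos
      omega
    rw [topMult, if_neg hm]
    push_cast [hle, (by omega : 2 ≤ 2 ^ d)]
    ring

theorem topMult_pos {m : ℕ} (hm : m ≠ 0) : 0 < topMult L d m := by
  have hP := four_le_two_pow_nat hd
  have hpow : 2 ^ d * (L + 1) + 1 ≤ (2 ^ d * (L + 1) + 1) ^ m := Nat.le_self_pow hm _
  have hmul := Nat.mul_le_mul hpow (by omega : 2 ≤ 2 ^ d - 2)
  have hL : 2 ^ d ≤ 2 ^ d * (L + 1) := Nat.le_mul_of_pos_right _ L.succ_pos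
  rw [topMult]
  omega

theorem expectedMult_top (m : ℕ) : expectedMult L d m (top d) = topMult L d m := by
  cases m with
  | zero =>
    have := four_le_two_pow_nat hd
    rw [expectedMult, topMult, pow_zero]
    omega
  | succ m => rw [expectedMult, if_pos rfl]

variable {L} (m : ℕ) {x y : ℝ}

theorem ne_top_of_eval_R_le (hy : (R (L + 2) d).eval y ≤ top d) : y ≠ top d := by
  rintro rfl
  exact (top_lt_eval_R_top L hd).not_ge hy

theorem expectedMult_of_eval_A (hy : (A (L + 2) d).eval y = 0) :
    expectedMult L d (m + 1) y = 2 ^ d - 1 := by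
  have hR := eval_R_of_eval_A hy
  rw [expectedMult, if_neg (ne_top_of_eval_R_le hd (hR.trans_le (top_pos hd).le)), if_pos hy]

theorem eval_A_ne_zero_of_eval_R (hy : (R (L + 2) d).eval y = top d) :
    (A (L + 2) d).eval y ≠ 0 := fun hA =>
  (top_pos hd).ne (hy ▸ eval_R_of_eval_A hA).symm

theorem expectedMult_of_eval_S (hy : (S (L + 2) d).eval y = 0) :
    expectedMult L d (m + 1) y = if m = 0 then 1 else 0 := by
  have hR := eval_R_of_eval_S hd hy
  rw [expectedMult, if_neg (ne_top_of_eval_R_le hd hR.le),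
    if_neg (eval_A_ne_zero_of_eval_R hd hR), if_pos hy]

theorem expectedMult_of_eval_cofactor (hy : (cofactor L d).eval y = 0) :
    expectedMult L d (m + 1) y = topMult L d m := by
  have hR := eval_R_of_eval_cofactor hd hy
  rw [expectedMult_succ_of_ne L d m (ne_top_of_eval_R_le hd hR.le)
    (eval_A_ne_zero_of_eval_R hd hR) (eval_S_ne_zero_of_eval_cofactor hd hy), hR,
    expectedMult_top L hd]

theorem expectedMult_of_eval_R (hx : x ∈ Set.Ico 0 (top d)) (hy : (R (L + 2) d).eval y = x)
    (hA : (A (L + 2) d).eval y ≠ 0) : expectedMult L d (m + 1) y = expectedMult L d m x := by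
  subst hy
  exact expectedMult_succ_of_ne L d m (ne_top_of_eval_R_le hd hx.2.le) hA
    fun hS => hx.2.ne (eval_R_of_eval_S hd hS)

theorem expectedMult_of_eval_R_mem_Ioo (hx : x ∈ Set.Ioo 0 (top d))
    (hy : (R (L + 2) d).eval y = x) : expectedMult L d (m + 1) y = expectedMult L d m x :=
  expectedMult_of_eval_R hd m ⟨hx.1.le, hx.2⟩ hy fun hA =>
    hx.1.ne (hy ▸ eval_R_of_eval_A hA).symm

theorem expectedMult_zero : expectedMult L d m 0 = 0 := by
  induction m with
  | zero => rfl
  | succ m ih =>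
    have hA : (A (L + 2) d).eval 0 ≠ 0 := fun hA => (mem_Ioo_of_eval_A hd hA).1.ne rfl
    rw [expectedMult_of_eval_R hd m ⟨le_rfl, top_pos hd⟩ (eval_R_zero L d) hA, ih]

end ExpectedMultiplicity

section LowerBound

variable {L d : ℕ} (hd : 2 ≤ d)
include hd

theorem three_le_card : 3 ≤ Fintype.card (Fin d → Bool) := by
  have := four_le_two_pow_nat hd
  simp
  omega

omit hd in
theorem tVal_add_card_sub_one (x : ℝ) :
    tVal d x + Fintype.card (Fin d → Bool) - 1 = 2 ^ d - (2 ^ d - 1) * x := by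
  simp only [Fintype.card_fun, Fintype.card_bool, Fintype.card_fin, tVal]
  push_cast
  ring

variable [NeZero d] (m : ℕ) {x : ℝ}

theorem topMult_le_dirichletMultiplicity :
    topMult L d m ≤ dirichletMultiplicity (L + 2) d m (top d) := by
  have hle := card_vertex_le_finrank_eigenspace_zero ℝ (level L d m)
  rw [card_level_vertex, card_level_cell, Fintype.card_fun, Fintype.card_bool,
    Fintype.card_fin] at hle
  rw [dirichletMultiplicity_eq_finrank, mul_top hd, sub_self, topMult]
  obtain ⟨p, hp⟩ := Nat.exists_eq_add_of_le' (four_le_two_pow_nat hd)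
  generalize (2 ^ d * (L + 1) + 1) ^ m = Z at *
  rw [hp] at hle ⊢
  grind

theorem le_dirichletMultiplicity_of_eval_A (hx : (A (L + 2) d).eval x = 0) :
    2 ^ d - 1 ≤ dirichletMultiplicity (L + 2) d (m + 1) x := by
  rw [eval_A] at hx
  have hle := le_finrank_eigenspace_refine_of_evalU_add_eq_zero (level L d m) opp_ne
    (three_le_card hd) (bdry_injective m) hx
  rw [card_level_vertex, card_level_cell, tVal_add_card_sub_one, Fintype.card_fun,
    Fintype.card_bool, Fintype.card_fin] at hle
  rw [dirichletMultiplicity_eq_finrank]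
  set e := Module.finrank ℝ ((level L d (m + 1)).eigenspace (2 ^ d - (2 ^ d - 1) * x))
  change _ ≤ e + _ + _ at hle
  obtain ⟨p, hp⟩ := Nat.exists_eq_add_of_le' (four_le_two_pow_nat hd)
  generalize (2 ^ d * (L + 1) + 1) ^ m = Z at *
  rw [hp] at hle ⊢
  grind

theorem one_le_dirichletMultiplicity_of_eval_S (hx : (S (L + 2) d).eval x = 0) :
    1 ≤ dirichletMultiplicity (L + 2) d 1 x := by
  have hcard : (Fintype.card (Fin d → Bool) : ℝ) = 2 ^ d := by simp
  rw [eval_S, ← hcard] at hx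
  have hle := one_le_finrank_eigenspace_refine_base opp_ne (three_le_card hd) hx
  rw [tVal_add_card_sub_one] at hle
  rwa [dirichletMultiplicity_eq_finrank]

omit hd in
theorem dirichletMultiplicity_eval_R_le (hA : (A (L + 2) d).eval x ≠ 0)
    (hS : (S (L + 2) d).eval x ≠ 0) :
    dirichletMultiplicity (L + 2) d m ((R (L + 2) d).eval x) ≤
      dirichletMultiplicity (L + 2) d (m + 1) x := by
  have hcard : (Fintype.card (Fin d → Bool) : ℝ) = 2 ^ d := by simp
  rw [dirichletMultiplicity_eq_finrank, dirichletMultiplicity_eq_finrank, two_pow_sub_eval_R,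
    eval_S, eval_cofactor, ← tVal_add_card_sub_one, ← hcard]
  exact finrank_eigenspace_le_refine (level L d m) (by rwa [← eval_A])
    (by rwa [hcard, ← eval_S]) opp_ne

theorem expectedMult_le_dirichletMultiplicity :
    expectedMult L d m x ≤ dirichletMultiplicity (L + 2) d m x := by
  induction m generalizing x with
  | zero => exact Nat.zero_le _
  | succ m ih =>
    by_cases htop : x = top d
    · rw [htop, expectedMult_top L hd]
      exact topMult_le_dirichletMultiplicity hd (m + 1)
    by_cases hA : (A (L + 2) d).eval x = 0
    · rw [expectedMult_of_eval_A hd m hA]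
      exact le_dirichletMultiplicity_of_eval_A hd m hA
    by_cases hS : (S (L + 2) d).eval x = 0
    · rw [expectedMult_of_eval_S hd m hS]
      split_ifs with hm
      · subst hm
        exact one_le_dirichletMultiplicity_of_eval_S hd hS
      · exact Nat.zero_le _
    rw [expectedMult_succ_of_ne L d m htop hA hS]
    exact ih.trans (dirichletMultiplicity_eval_R_le m hA hS)

end LowerBound

section Counting

variable (L d : ℕ)

open Classical in
/-- All values that can be Dirichlet eigenvalues at level `m`: the iterated preimages of `0` and
`top d` under `R`. The point `0` itself is only kept for the recursion. -/
def candidates : ℕ → Finset ℝ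
  | 0 => {0, top d}
  | m + 1 => insert (top d) ((candidates m).biUnion (fiber L d))

variable {L d} (hd : 2 ≤ d) {m : ℕ} {x : ℝ}
include hd

theorem mem_Icc_of_mem_candidates (hx : x ∈ candidates L d m) : x ∈ Set.Icc 0 (top d) := by
  induction m generalizing x with
  | zero =>
    obtain rfl | rfl : x = 0 ∨ x = top d := by simpa [candidates] using hx
    · exact ⟨le_rfl, (top_pos hd).le⟩
    · exact top_mem_Icc hd
  | succ m ih =>
    rw [candidates, Finset.mem_insert, Finset.mem_biUnion] at hx
    obtain rfl | ⟨y, hy, hxy⟩ := hx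
    · exact top_mem_Icc hd
    · exact Set.Ico_subset_Icc_self (mem_Ico_of_eval_R hd (ih hy) ((mem_fiber L hd).1 hxy))

omit hd in
theorem top_mem_candidates : top d ∈ candidates L d m := by
  cases m <;> simp [candidates]

theorem zero_mem_candidates : 0 ∈ candidates L d m := by
  induction m with
  | zero => simp [candidates]
  | succ m ih =>
    rw [candidates, Finset.mem_insert, Finset.mem_biUnion]
    exact .inr ⟨0, ih, (mem_fiber L hd).2 (eval_R_zero L d)⟩

theorem top_notMem_biUnion_fiber : top d ∉ (candidates L d m).biUnion (fiber L d) := by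
  rw [Finset.mem_biUnion]
  rintro ⟨y, hy, hxy⟩
  exact (mem_Ico_of_eval_R hd (mem_Icc_of_mem_candidates hd hy) ((mem_fiber L hd).1 hxy)).2.ne rfl

theorem pairwiseDisjoint_fiber (s : Set ℝ) : s.PairwiseDisjoint (fiber L d) :=
  fun _ _ _ _ hne => Finset.disjoint_left.2 fun _ hy hy' =>
    hne (((mem_fiber L hd).1 hy).symm.trans ((mem_fiber L hd).1 hy'))

variable (L m)

theorem sum_fiber_zero :
    ∑ y ∈ fiber L d 0, expectedMult L d (m + 1) y = (L + 1) * (2 ^ d - 1) := by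
  have hA := A_ne_zero L hd
  have hsub : (A (L + 2) d).roots.toFinset ⊆ fiber L d 0 := fun y hy =>
    (mem_fiber L hd).2 (eval_R_of_eval_A ((mem_roots_toFinset hA).1 hy))
  rw [← Finset.sum_subset hsub fun y hy hyA => ?_,
    Finset.sum_congr rfl fun y hy => expectedMult_of_eval_A hd m ((mem_roots_toFinset hA).1 hy),
    Finset.sum_const, card_roots_A_toFinset L hd, smul_eq_mul]
  rw [expectedMult_of_eval_R hd m ⟨le_rfl, top_pos hd⟩ ((mem_fiber L hd).1 hy)
    (mt (mem_roots_toFinset hA).2 hyA), expectedMult_zero hd]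

theorem sum_fiber_top : ∑ y ∈ fiber L d (top d), expectedMult L d (m + 1) y =
    (L + 2) * (if m = 0 then 1 else 0) + (L + 1) * topMult L d m := by
  rw [fiber_top L hd, Finset.sum_union (disjoint_roots_S_cofactor L hd),
    Finset.sum_congr rfl fun y hy =>
      expectedMult_of_eval_S hd m ((mem_roots_toFinset (S_ne_zero L hd)).1 hy),
    Finset.sum_congr rfl fun y hy =>
      expectedMult_of_eval_cofactor hd m ((mem_roots_toFinset (cofactor_ne_zero L hd)).1 hy),
    Finset.sum_const, Finset.sum_const, card_roots_S_toFinset L hd,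
    card_roots_cofactor_toFinset L hd, smul_eq_mul, smul_eq_mul]

theorem sum_fiber_of_mem_Ioo (hx : x ∈ Set.Ioo 0 (top d)) :
    ∑ y ∈ fiber L d x, expectedMult L d (m + 1) y = (2 * L + 3) * expectedMult L d m x := by
  rw [Finset.sum_congr rfl fun y hy =>
      expectedMult_of_eval_R_mem_Ioo hd m hx ((mem_fiber L hd).1 hy),
    Finset.sum_const, card_fiber hd (Set.Ioo_subset_Icc_self hx), smul_eq_mul]

variable {L m}

theorem sum_fiber (hx : x ∈ candidates L d m) :
    ∑ y ∈ fiber L d x, (expectedMult L d (m + 1) y : ℤ) =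
      (2 * L + 3) * expectedMult L d m x + (if x = 0 then (L + 1 : ℤ) * (2 ^ d - 1) else 0) -
        if x = top d then (L + 2 : ℤ) * ((2 ^ d * (L + 1) + 1) ^ m * (2 ^ d - 2) + 1 - 2 ^ d)
        else 0 := by
  have htop := (top_pos hd).ne'
  have hIcc := mem_Icc_of_mem_candidates hd hx
  rw [← Nat.cast_sum]
  rcases eq_or_ne x 0 with rfl | h0
  · rw [sum_fiber_zero L hd, expectedMult_zero hd, if_pos rfl, if_neg htop.symm]
    push_cast [Nat.one_le_two_pow]
    ring
  rcases eq_or_ne x (top d) with rfl | h1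
  · rw [sum_fiber_top L hd, expectedMult_top L hd, if_neg htop, if_pos rfl]
    push_cast
    linear_combination (-(L : ℤ) - 2) * cast_topMult L hd m
  · rw [sum_fiber_of_mem_Ioo L hd m ⟨hIcc.1.lt_of_ne' h0, hIcc.2.lt_of_ne h1⟩, if_neg h0,
      if_neg h1]
    push_cast
    ring

variable (L m)

theorem sum_expectedMult_candidates : ∑ x ∈ candidates L d m, (expectedMult L d m x : ℤ) =
    (2 ^ d - 1) * ((2 ^ d * (L + 1) + 1) ^ m - 1) := by
  induction m with
  | zero => simp [expectedMult]
  | succ m ih =>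
    rw [candidates, Finset.sum_insert (top_notMem_biUnion_fiber hd),
      Finset.sum_biUnion (pairwiseDisjoint_fiber hd _), Finset.sum_congr rfl fun x => sum_fiber hd,
      Finset.sum_sub_distrib, Finset.sum_add_distrib, Finset.sum_ite_eq', Finset.sum_ite_eq',
      if_pos (zero_mem_candidates hd), if_pos top_mem_candidates, ← Finset.mul_sum, ih,
      expectedMult_top L hd, cast_topMult L hd, if_neg m.succ_ne_zero]
    ring

variable {L}

theorem dirichletMultiplicity_eq_expectedMult (x : ℝ) :
    dirichletMultiplicity (L + 2) d m x = expectedMult L d m x := by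
  classical
  have : NeZero d := ⟨by omega⟩
  have hle (y : ℝ) : expectedMult L d m y ≤ dirichletMultiplicity (L + 2) d m y :=
    expectedMult_le_dirichletMultiplicity hd m
  have htotal : ∑ y ∈ insert x (candidates L d m), dirichletMultiplicity (L + 2) d m y ≤
      ∑ y ∈ insert x (candidates L d m), expectedMult L d m y := by
    refine le_trans ?_ (Finset.sum_le_sum_of_subset (Finset.subset_insert x _))
    have hupper := sum_dirichletMultiplicity_le (L := L) (d := d) m (insert x (candidates L d m))
    have hlower := sum_expectedMult_candidates L hd m
    rw [card_level_vertex] at hupper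
    zify [Nat.one_le_two_pow] at hupper ⊢
    linarith
  exact ((Finset.sum_eq_sum_iff_of_le fun y _ => hle y).1
    ((Finset.sum_le_sum fun y _ => hle y).antisymm htotal) x (Finset.mem_insert_self _ _)).symm

end Counting

section Words

/-- `y` is one of the numbers from which the word `v` produces a Dirichlet eigenvalue
`branchWord (L + 2) d v y` at level `m`. -/
inductive IsSeed (L d m : ℕ) (v : List (Fin (2 * (L + 2) - 1))) : ℝ → Prop
  | endpoint : v.length < m → Admissible v → IsSeed L d m v (top d)
  | rootS {α : ℝ} : (S (L + 2) d).IsRoot α → v.length + 1 = m → IsSeed L d m v α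
  | rootA {β : ℝ} : (A (L + 2) d).IsRoot β → v.length < m → IsSeed L d m v β

variable {L d : ℕ} (hd : 2 ≤ d) (v : List (Fin (2 * (L + 2) - 1))) {x y : ℝ}
include hd

theorem branchWord_mem_Ioc (hy : y ∈ Set.Ioc 0 (top d)) :
    branchWord (L + 2) d v y ∈ Set.Ioc 0 (top d) := by
  induction v generalizing y with
  | nil => exact hy
  | cons l _ ih => exact ih (Set.Ioo_subset_Ioc_self (branch_mem_Ioo hd hy l))

theorem expectedMult_branchWord (k : ℕ) (hy : y ∈ Set.Ioo 0 (top d)) :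
    expectedMult L d (k + v.length) (branchWord (L + 2) d v y) = expectedMult L d k y := by
  induction v generalizing k y with
  | nil => rfl
  | cons l v ih =>
    rw [List.length_cons, ← add_assoc, add_right_comm]
    exact (ih (k + 1) (branch_mem_Ioo hd (Set.Ioo_subset_Ioc_self hy) l)).trans
      (expectedMult_of_eval_R_mem_Ioo hd k hy (eval_R_branch hd (Set.Ioo_subset_Icc_self hy) l))

variable {v} in
theorem expectedMult_branchWord_top (hv : Admissible v) (k : ℕ) :
    expectedMult L d (k + v.length) (branchWord (L + 2) d v (top d)) = topMult L d k := by
  cases v with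
  | nil => exact expectedMult_top L hd k
  | cons l v =>
    rw [List.length_cons, ← add_assoc, add_right_comm]
    have hcof := (eval_cofactor_branch_top_eq_zero_iff hd l).2 (hv l (by simp))
    exact (expectedMult_branchWord hd v (k + 1) (branch_mem_Ioo hd ⟨top_pos hd, le_rfl⟩ l)).trans
      (expectedMult_of_eval_cofactor hd k hcof)

theorem exists_branchWord_append_singleton_eq (hy : y ∈ Set.Ioc 0 (top d))
    (hx : (R (L + 2) d).eval x = branchWord (L + 2) d v y) :
    ∃ l, branchWord (L + 2) d (v ++ [l]) y = x := by
  obtain ⟨l, hl⟩ := exists_branch_eq hd (Set.Ioc_subset_Icc_self (branchWord_mem_Ioc hd v hy)) hx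
  refine ⟨l, ?_⟩
  rw [branchWord, List.foldl_append]
  exact hl

variable {v} {m : ℕ}

theorem Admissible.append_singleton (hv : Admissible v) {l : Fin (2 * (L + 2) - 1)}
    (hR : (R (L + 2) d).eval (branchWord (L + 2) d (v ++ [l]) (top d)) =
      branchWord (L + 2) d v (top d))
    (hS : (S (L + 2) d).eval (branchWord (L + 2) d (v ++ [l]) (top d)) ≠ 0) :
    Admissible (v ++ [l]) := by
  cases v with
  | nil =>
    have hcof := ((eval_R_eq_top_iff L hd).1 hR).resolve_left hS
    have hl := (eval_cofactor_branch_top_eq_zero_iff hd l).1 hcof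
    simpa [Admissible] using hl
  | cons l₀ v => simpa [Admissible] using hv

theorem IsSeed.mem_Ioc (h : IsSeed L d m v y) : y ∈ Set.Ioc 0 (top d) := by
  cases h with
  | endpoint => exact ⟨top_pos hd, le_rfl⟩
  | rootS hα => exact Set.Ioo_subset_Ioc_self (mem_Ioo_of_eval_S hd hα)
  | rootA hβ => exact Set.Ioo_subset_Ioc_self (mem_Ioo_of_eval_A hd hβ)

theorem IsSeed.append_singleton (h : IsSeed L d m v y) {l : Fin (2 * (L + 2) - 1)}
    (hR : (R (L + 2) d).eval (branchWord (L + 2) d (v ++ [l]) y) = branchWord (L + 2) d v y)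
    (hS : (S (L + 2) d).eval (branchWord (L + 2) d (v ++ [l]) y) ≠ 0) :
    IsSeed L d (m + 1) (v ++ [l]) y := by
  cases h with
  | endpoint hv hadm => exact .endpoint (by simpa using hv) (hadm.append_singleton hd hR hS)
  | rootS hα hv => exact .rootS hα (by simpa using hv)
  | rootA hβ hv => exact .rootA hβ (by simpa using hv)

theorem exists_isSeed_of_expectedMult_ne_zero (hx : expectedMult L d m x ≠ 0) :
    ∃ v y, IsSeed L d m v y ∧ branchWord (L + 2) d v y = x := by
  induction m generalizing x with
  | zero => exact absurd rfl hx
  | succ m ih =>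
    by_cases htop : x = top d
    · exact ⟨[], x, htop ▸ .endpoint m.succ_pos (by simp [Admissible]), rfl⟩
    by_cases hA : (A (L + 2) d).eval x = 0
    · exact ⟨[], x, .rootA hA m.succ_pos, rfl⟩
    by_cases hS : (S (L + 2) d).eval x = 0
    · rw [expectedMult_of_eval_S hd m hS, ne_eq, ite_eq_right_iff, Classical.not_imp] at hx
      exact ⟨[], x, .rootS hS (by simp [hx.1]), rfl⟩
    rw [expectedMult_succ_of_ne L d m htop hA hS] at hx
    obtain ⟨v, y, hseed, hRx⟩ := ih hx
    obtain ⟨l, rfl⟩ := exists_branchWord_append_singleton_eq hd v (hseed.mem_Ioc hd) hRx.symm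
    exact ⟨v ++ [l], y, hseed.append_singleton hd hRx.symm hS, rfl⟩

theorem dirichletMultiplicity_branchWord_top (hv : v.length ≤ m) (hadm : Admissible v) :
    dirichletMultiplicity (L + 2) d m (branchWord (L + 2) d v (top d)) =
      topMult L d (m - v.length) := by
  rw [dirichletMultiplicity_eq_expectedMult hd, ← expectedMult_branchWord_top hd hadm,
    Nat.sub_add_cancel hv]

theorem dirichletMultiplicity_branchWord_of_eval_S (hy : (S (L + 2) d).eval y = 0)
    (hv : v.length + 1 = m) :
    dirichletMultiplicity (L + 2) d m (branchWord (L + 2) d v y) = 1 := by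
  rw [dirichletMultiplicity_eq_expectedMult hd, ← hv, add_comm,
    expectedMult_branchWord hd v 1 (mem_Ioo_of_eval_S hd hy), expectedMult_of_eval_S hd 0 hy,
    if_pos rfl]

theorem dirichletMultiplicity_branchWord_of_eval_A (hy : (A (L + 2) d).eval y = 0)
    (hv : v.length < m) :
    dirichletMultiplicity (L + 2) d m (branchWord (L + 2) d v y) = 2 ^ d - 1 := by
  obtain ⟨k, rfl⟩ := Nat.exists_eq_add_of_le' (Nat.succ_le_of_lt hv)
  rw [dirichletMultiplicity_eq_expectedMult hd, Nat.succ_eq_one_add, ← add_assoc,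
    expectedMult_branchWord hd v (k + 1) (mem_Ioo_of_eval_A hd hy), expectedMult_of_eval_A hd k hy]

theorem mem_dirichletSpectrum_iff : x ∈ dirichletSpectrum (L + 2) d m ↔
    ∃ v y, IsSeed L d m v y ∧ branchWord (L + 2) d v y = x := by
  have hiff : x ∈ dirichletSpectrum (L + 2) d m ↔ dirichletMultiplicity (L + 2) d m x ≠ 0 :=
    (not_congr Submodule.finrank_eq_zero).symm
  refine hiff.trans ⟨fun hx => ?_, ?_⟩
  · rw [dirichletMultiplicity_eq_expectedMult hd] at hx
    exact exists_isSeed_of_expectedMult_ne_zero hd hx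
  · rintro ⟨v, y, ⟨hv, hadm⟩ | ⟨hα, hv⟩ | ⟨hβ, hv⟩, rfl⟩
    · rw [dirichletMultiplicity_branchWord_top hd hv.le hadm]
      exact (topMult_pos L hd (by omega)).ne'
    · rw [dirichletMultiplicity_branchWord_of_eval_S hd hα hv]
      exact one_ne_zero
    · have := four_le_two_pow_nat hd
      rw [dirichletMultiplicity_branchWord_of_eval_A hd hβ hv]
      omega

variable (L m) in
theorem dirichletSpectrum_eq : dirichletSpectrum (L + 2) d (m + 1) =
    {lam | ∃ v : List (Fin (2 * (L + 2) - 1)), v.length ≤ m ∧ Admissible v ∧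
      lam = branchWord (L + 2) d v (top d)} ∪
    {lam | ∃ α, (S (L + 2) d).IsRoot α ∧ ∃ v : List (Fin (2 * (L + 2) - 1)), v.length = m ∧
      lam = branchWord (L + 2) d v α} ∪
    {lam | ∃ β, (A (L + 2) d).IsRoot β ∧ ∃ v : List (Fin (2 * (L + 2) - 1)), v.length ≤ m ∧
      lam = branchWord (L + 2) d v β} := by
  ext x
  rw [mem_dirichletSpectrum_iff hd]
  constructor
  · rintro ⟨v, y, ⟨hv, hadm⟩ | ⟨hα, hv⟩ | ⟨hβ, hv⟩, rfl⟩
    · exact .inl (.inl ⟨v, by omega, hadm, rfl⟩)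
    · exact .inl (.inr ⟨y, hα, v, by omega, rfl⟩)
    · exact .inr ⟨y, hβ, v, by omega, rfl⟩
  · rintro ((⟨v, hv, hadm, rfl⟩ | ⟨α, hα, v, hv, rfl⟩) | ⟨β, hβ, v, hv, rfl⟩)
    · exact ⟨v, _, .endpoint (by omega) hadm, rfl⟩
    · exact ⟨v, _, .rootS hα (by omega), rfl⟩
    · exact ⟨v, _, .rootA hβ (by omega), rfl⟩

end Words

end

end Vicsek

theorem theorem4p3 (n d m : ℕ) (hn : 2 ≤ n) (hd : 2 ≤ d) (hm : 1 ≤ m) :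
    -- the inverse branches and the roots that label the families are well defined
    (∀ x ∈ Set.Icc (0 : ℝ) (Vicsek.top d),
      {y : ℝ | (Vicsek.R n d).eval y = x}.ncard = 2 * n - 1 ∧
      {y : ℝ | (Vicsek.R n d).eval y = x} ⊆ Set.Icc 0 (Vicsek.top d)) ∧
    ({y : ℝ | (Vicsek.S n d).IsRoot y}.ncard = n ∧
      {y : ℝ | (Vicsek.S n d).IsRoot y} ⊆ Set.Icc 0 (Vicsek.top d)) ∧
    ({y : ℝ | (Vicsek.A n d).IsRoot y}.ncard = n - 1 ∧
      {y : ℝ | (Vicsek.A n d).IsRoot y} ⊆ Set.Icc 0 (Vicsek.top d)) ∧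
    -- the spectrum
    Vicsek.dirichletSpectrum n d m =
      {lam | ∃ v : List (Fin (2 * n - 1)), v.length ≤ m - 1 ∧ Vicsek.Admissible v ∧
        lam = Vicsek.branchWord n d v (Vicsek.top d)} ∪
      {lam | ∃ α : ℝ, (Vicsek.S n d).IsRoot α ∧ ∃ v : List (Fin (2 * n - 1)),
        v.length = m - 1 ∧ lam = Vicsek.branchWord n d v α} ∪
      {lam | ∃ β : ℝ, (Vicsek.A n d).IsRoot β ∧ ∃ v : List (Fin (2 * n - 1)),
        v.length ≤ m - 1 ∧ lam = Vicsek.branchWord n d v β} ∧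
    -- the multiplicities
    (∀ v : List (Fin (2 * n - 1)), v.length ≤ m - 1 → Vicsek.Admissible v →
      (Vicsek.dirichletMultiplicity n d m (Vicsek.branchWord n d v (Vicsek.top d)) : ℤ) =
        (2 ^ d * n - 2 ^ d + 1) ^ (m - v.length) * (2 ^ d - 2) + 1 - 2 ^ d) ∧
    (∀ α : ℝ, (Vicsek.S n d).IsRoot α → ∀ v : List (Fin (2 * n - 1)), v.length = m - 1 →
      Vicsek.dirichletMultiplicity n d m (Vicsek.branchWord n d v α) = 1) ∧
    (∀ β : ℝ, (Vicsek.A n d).IsRoot β → ∀ v : List (Fin (2 * n - 1)), v.length ≤ m - 1 →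
      Vicsek.dirichletMultiplicity n d m (Vicsek.branchWord n d v β) = 2 ^ d - 1) := by
  obtain ⟨L, rfl⟩ := Nat.exists_eq_add_of_le' hn
  obtain ⟨m, rfl⟩ := Nat.exists_eq_add_of_le' hm
  refine ⟨fun x hx => ⟨Vicsek.ncard_setOf_eval_R_eq hd hx, fun y hy =>
      Set.Ico_subset_Icc_self (Vicsek.mem_Ico_of_eval_R hd hx hy)⟩,
    ⟨(Vicsek.ncard_setOf_eval_eq_zero (Vicsek.S_ne_zero L hd)).trans
      (Vicsek.card_roots_S_toFinset L hd), fun y hy =>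
      Set.Ioo_subset_Icc_self (Vicsek.mem_Ioo_of_eval_S hd hy)⟩,
    ⟨(Vicsek.ncard_setOf_eval_eq_zero (Vicsek.A_ne_zero L hd)).trans
      (Vicsek.card_roots_A_toFinset L hd), fun y hy =>
      Set.Ioo_subset_Icc_self (Vicsek.mem_Ioo_of_eval_A hd hy)⟩,
    Vicsek.dirichletSpectrum_eq L hd m, fun v hv hadm => ?_,
    fun α hα v hv => Vicsek.dirichletMultiplicity_branchWord_of_eval_S hd hα (by omega),
    fun β hβ v hv => Vicsek.dirichletMultiplicity_branchWord_of_eval_A hd hβ (by omega)⟩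
  rw [Vicsek.dirichletMultiplicity_branchWord_top hd (by omega) hadm, Vicsek.cast_topMult L hd,
    if_neg (by omega)]
  push_cast
  ring
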